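/- **Setting.** Fix $n \ge 0$ and a Hessenberg function $h\colon [n]\to[n]$, i.e. $i \le h(i)$ for all $i$ and $h$ is weakly increasing. Let $\mathbf L=(L_1,\dots,L_n)$ and $\mathbf R=(R_1,\dots,R_n)$ be two sets of indeterminates, let $B$ be the set of bijections $\beta\colon\mathbf R\to\mathbf L$, and let $\mathcal T=\prod_{\beta\in B}\mathbb C[\mathbf L]$, graded by total degree, with $\mathbf 1_\beta\in\mathcal T$ the element which is $1$ at coordinate $\beta$ and $0$ elsewhere. Identify $\mathbb C[\mathbf L]$ with the constant families in $\mathcal T$, and $\mathbb C[\mathbf R]$ with the families $\big(g(\beta(R_1),\dots,\beta(R_n))\big)_{\beta}$, $g\in\mathbb C[\mathbf R]$. Every $x \in\mathcal T$ is determined by the polynomials $g_\beta\in\mathbb C[\mathbf R]$ for which $x$ has coordinate $g_\beta(\beta(R_1),\dots,\beta(R_n))$ at $\beta$. Let $\mathcal T_h\subseteq\mathcal T$ be the subring of those $x$ such that $g_\beta-g_{\beta\circ(R_i\leftrightarrow R_j)}$ is divisible by $R_i-R_j$ for all $\beta \in B$ and all $i<j\le h(i)$; it contains $\mathbb C[\mathbf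 L]$ and $\mathbb C[\mathbf R]$. The symmetric group $S_n$ acts on $\mathcal T$ by the dot action, $w\cdot(f(L_1,\dots,L_n)\mathbf 1_\beta)=f(L_{w(1)},\dots,L_{w(n)})\mathbf 1_{w\circ\beta}$, where $w$ acts on $\mathbf L$ by $w(L_i)=L_{w(i)}$. This action preserves the grading and $\mathcal T_h$; it permutes the indeterminates of $\mathbb C[\mathbf L]$ and fixes $\mathbb C[\mathbf R]$ pointwise. For a graded $S_n$-stable ring $M \subseteq \mathcal T$ that is free, with a homogeneous basis $(e_i)$, over a graded subring $A$, put $$\operatorname{tr}_q(w,M,A)=\sum_i q^{\deg e_i}\,(\text{coefficient of } e_i \text{ in } w\cdot e_i)\in\mathbb C[[q]],\qquad \operatorname{Frob}_q(S_n,M,A)=\frac1{n!}\sum_{w\in S_n}\operatorname{tr}_q(w,M,A)\,p_{\text{cycle type of }w},$$ a symmetric function with coefficients in $\mathbb C[[q]]$, where $p_\lambda$ are the power-sum symmetric functions. The Kronecker product $\star$ is the bilinear product of symmetric functions with $p_\lambda\star p_\lambda=z(\lambda)p_\lambda$ and $p_\lambda\star p_\mu=0$ for $\lambda\ne\mu$,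 where $z(\lambda)=\prod_{i} i^{m_i}m_i!$ and $m_i$ is the number of parts of $\lambda$ equal to $i$. **Lemma.** For every $w \in S_n$ the graded traces of $w$ on $\mathcal T_h$ over $\mathbb C$, over $\mathbb C[\mathbf L]$ and over $\mathbb C[\mathbf R]$, and on $\mathbb C[\mathbf L]$ and $\mathbb C[\mathbf R]$ over $\mathbb C$, are well defined: homogeneous bases exist, the coefficients involved are complex numbers, every homogeneous basis has finitely many elements in each degree, and the result does not depend on the basis. Moreover $$\operatorname{Frob}_q(S_n,\mathcal T_h,\mathbb C)=\operatorname{Frob}_q(S_n,\mathcal T_h,\mathbb C[\mathbf L])\star\operatorname{Frob}_q(S_n,\mathbb C[\mathbf L],\mathbb C)=\operatorname{Frob}_q(S_n,\mathcal T_h,\mathbb C[\mathbf R])\star\operatorname{Frob}_q(S_n,\mathbb C[\mathbf R],\mathbb C).$$ -/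

import Mathlib

noncomputable section

namespace SymFun

/-! ### Symmetric functions -/

/-- The ring of symmetric functions over `K` in the indeterminates `x₀, x₁, x₂, …`: formal power
series of bounded degree which are invariant under all permutations of the indeterminates. -/
def Sym (K : Type*) [CommRing K] : Subalgebra K (MvPowerSeries ℕ K) where
  carrier := {f | (∃ d : ℕ, ∀ m : ℕ →₀ ℕ, d < m.degree → MvPowerSeries.coeff m f = 0) ∧
    ∀ e : Equiv.Perm ℕ, MvPowerSeries.rename e f = f}
  mul_mem' := by
    classical
    rintro f g ⟨⟨d, hd⟩, hf⟩ ⟨⟨d', hd'⟩, hg⟩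
    refine ⟨⟨d + d', fun m hm => ?_⟩, fun e => by rw [map_mul, hf, hg]⟩
    rw [MvPowerSeries.coeff_mul]
    refine Finset.sum_eq_zero fun p hp => ?_
    rw [Finset.HasAntidiagonal.mem_antidiagonal] at hp
    have h1 : p.1.degree + p.2.degree = m.degree := by rw [← hp, map_add]
    rcases lt_or_ge d p.1.degree with h | h
    · rw [hd _ h, zero_mul]
    · rw [hd' p.2 (by omega), mul_zero]
  add_mem' := by
    rintro f g ⟨⟨d, hd⟩, hf⟩ ⟨⟨d', hd'⟩, hg⟩
    refine ⟨⟨d + d', fun m hm => ?_⟩, fun e => by rw [map_add, hf, hg]⟩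
    rw [map_add, hd m (by omega), hd' m (by omega), add_zero]
  algebraMap_mem' := by
    classical
    intro r
    refine ⟨⟨0, fun m hm => ?_⟩, fun e => AlgHom.commutes _ _⟩
    have hm' : m ≠ 0 := by rintro rfl; simp at hm
    rw [MvPowerSeries.algebraMap_apply, MvPowerSeries.coeff_C, if_neg hm']

/-- The power sum `p_k = ∑ᵢ xᵢ ^ k`, for `k ≥ 1`, as a formal power series. -/
def psumSeries (K : Type*) [CommSemiring K] (k : ℕ) : MvPowerSeries ℕ K :=
  open Classical in fun m => if ∃ i, m = Finsupp.single i k then 1 else 0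

/-- The product of the power sums `p_k` for `k` in the multiset `s`. -/
def psumProd (K : Type*) [CommSemiring K] (s : Multiset ℕ) : MvPowerSeries ℕ K :=
  (s.map (psumSeries K)).prod

/-- The multiset of nonzero exponents of a monomial. -/
def expType (m : ℕ →₀ ℕ) : Multiset ℕ := m.support.val.map m

lemma coeff_psumSeries (K : Type*) [CommSemiring K] (k : ℕ) (m : ℕ →₀ ℕ) :
    MvPowerSeries.coeff m (psumSeries K k) =
      open Classical in if ∃ i, m = Finsupp.single i k then 1 else 0 := rfl

lemma coeff_psumProd_cast (K : Type*) [CommRing K] (s : Multiset ℕ) (m : ℕ →₀ ℕ) :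
    MvPowerSeries.coeff m (psumProd K s) =
      ((MvPowerSeries.coeff m (psumProd ℕ s) : ℕ) : K) := by
  have h : psumProd K s = MvPowerSeries.map (Nat.castRingHom K) (psumProd ℕ s) := by
    unfold psumProd
    rw [map_multiset_prod, Multiset.map_map]
    congr 1
    refine Multiset.map_congr rfl fun k _ => ?_
    ext m
    rw [Function.comp_apply, MvPowerSeries.coeff_map, coeff_psumSeries, coeff_psumSeries]
    split_ifs <;> simp
  rw [h, MvPowerSeries.coeff_map]; rfl

lemma expType_add_single {m : ℕ →₀ ℕ} {i a : ℕ} (hi : i ∉ m.support) (ha : a ≠ 0) :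
    expType (Finsupp.single i a + m) = a ::ₘ expType m := by
  classical
  have hmi : m i = 0 := by simpa using hi
  have hs : (Finsupp.single i a + m).support = insert i m.support := by
    ext j
    by_cases hj : j = i
    · subst hj; simp [ha]
    · simp [hj]
  unfold expType
  rw [hs, Finset.insert_val_of_notMem hi, Multiset.map_cons]
  congr 1
  · simp [hmi]
  · refine Multiset.map_congr rfl fun j hj => ?_
    have hji : i ≠ j := by rintro rfl; exact hi hj
    simp [hji]

lemma coeff_psumProd_ne_zero {s : Multiset ℕ} (hs : ∀ a ∈ s, 0 < a) :
    ∀ {m : ℕ →₀ ℕ}, MvPowerSeries.coeff m (psumProd ℕ s) ≠ 0 →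
      m.degree = s.sum ∧ m.support.card ≤ s.card ∧
        (m.support.card = s.card → expType m = s) := by
  classical
  induction s using Multiset.induction_on with
  | empty =>
    intro m hm
    have : m = 0 := by
      by_contra h
      apply hm
      simp [psumProd, MvPowerSeries.coeff_one, h]
    subst this
    simp [expType]
  | cons a s ih =>
    intro m hm
    have ha : a ≠ 0 := (hs a (by simp)).ne'
    have ih' := @ih (fun b hb => hs b (by simp [hb]))
    have hp : psumProd ℕ (a ::ₘ s) = psumSeries ℕ a * psumProd ℕ s := by simp [psumProd]
    rw [hp, MvPowerSeries.coeff_mul] at hm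
    obtain ⟨p, hp, hne⟩ := Finset.exists_ne_zero_of_sum_ne_zero hm
    rw [Finset.HasAntidiagonal.mem_antidiagonal] at hp
    have h1 := left_ne_zero_of_mul hne
    obtain ⟨h0, h2⟩ := ih' (right_ne_zero_of_mul hne)
    rw [coeff_psumSeries] at h1
    obtain ⟨i, hi⟩ : ∃ i, p.1 = Finsupp.single i a := by
      by_contra h
      exact h1 (if_neg h)
    rw [hi] at hp
    refine ⟨by rw [← hp, map_add, h0, Multiset.sum_cons]; simp, ?_⟩
    by_cases hmem : i ∈ p.2.support
    · have hsub : m.support ⊆ p.2.support := by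
        intro j hj
        by_cases hji : j = i
        · exact hji ▸ hmem
        · rw [← hp] at hj
          simpa [Finsupp.single_apply, hji, Ne.symm hji] using hj
      have hc := Finset.card_le_card hsub
      rw [Multiset.card_cons]
      exact ⟨by omega, fun h => by omega⟩
    · have ht : expType m = a ::ₘ expType p.2 := by rw [← hp]; exact expType_add_single hmem ha
      have hc : m.support.card = p.2.support.card + 1 := by
        have := congrArg Multiset.card ht
        simpa [expType] using this
      rw [Multiset.card_cons]
      refine ⟨by omega, fun h => ?_⟩
      rw [ht, h2.2 (by omega)]

lemma coeff_psumProd_expType {s : Multiset ℕ} :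
    ∀ {m : ℕ →₀ ℕ}, expType m = s → MvPowerSeries.coeff m (psumProd ℕ s) ≠ 0 := by
  classical
  induction s using Multiset.induction_on with
  | empty =>
    intro m hm
    have : m = 0 := by simpa [expType] using hm
    subst this
    simp [psumProd]
  | cons a s ih =>
    intro m hm
    have hmem : a ∈ expType m := by rw [hm]; simp
    obtain ⟨i, hi, hia⟩ := Multiset.mem_map.1 hmem
    have hi' : m i ≠ 0 := Finsupp.mem_support_iff.1 hi
    have hdec : Finsupp.single i a + m.erase i = m := by
      rw [← hia]; exact Finsupp.single_add_erase i m
    have ht : expType (m.erase i) = s := by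
      have h := expType_add_single (m := m.erase i) (i := i) (a := a) (by simp) (hia ▸ hi')
      rw [hdec, hm] at h
      exact ((Multiset.cons_inj_right a).1 h).symm
    have hp : psumProd ℕ (a ::ₘ s) = psumSeries ℕ a * psumProd ℕ s := by simp [psumProd]
    rw [hp, MvPowerSeries.coeff_mul]
    intro h0
    have := Finset.sum_eq_zero_iff.1 h0 (Finsupp.single i a, m.erase i)
      (Finset.HasAntidiagonal.mem_antidiagonal.2 hdec)
    rcases mul_eq_zero.1 this with h | h
    · rw [coeff_psumSeries, if_pos ⟨i, rfl⟩] at h; exact one_ne_zero h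
    · exact ih ht h

lemma exists_expType {s : Multiset ℕ} (hs : ∀ a ∈ s, 0 < a) : ∃ m : ℕ →₀ ℕ, expType m = s := by
  induction s using Multiset.induction_on with
  | empty => exact ⟨0, by simp [expType]⟩
  | cons a s ih =>
    obtain ⟨m, hm⟩ := ih (fun b hb => hs b (by simp [hb]))
    obtain ⟨i, hi⟩ := Infinite.exists_notMem_finset m.support
    exact ⟨_, by rw [expType_add_single hi (hs a (by simp)).ne', hm]⟩

lemma expType_sum (m : ℕ →₀ ℕ) : (expType m).sum = m.degree := rfl

lemma expType_pos {m : ℕ →₀ ℕ} {a : ℕ} (ha : a ∈ expType m) : 0 < a := by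
  obtain ⟨i, hi, rfl⟩ := Multiset.mem_map.1 ha
  exact Nat.pos_of_ne_zero (Finsupp.mem_support_iff.1 hi)

lemma exists_perm {m m' : ℕ →₀ ℕ} (h : expType m = expType m') :
    ∃ e : Equiv.Perm ℕ, ∀ i, m' (e i) = m i := by
  classical
  have key : ∀ c, Nonempty ({a // m a = c} ≃ {b // m' b = c}) := by
    intro c
    by_cases hc : c = 0
    · have aux : ∀ k : ℕ →₀ ℕ, Infinite {a // k a = c} := by
        intro k
        have : {a | k a = c} = (↑k.support : Set ℕ)ᶜ := by
          ext a; simp [hc]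
        exact Set.infinite_coe_iff.2 (by
          rw [show (fun a => k a = c) = {a | k a = c} from rfl, this]
          exact k.support.finite_toSet.infinite_compl)
      have := aux m
      have := aux m'
      exact nonempty_equiv_of_countable
    · have aux : ∀ k : ℕ →₀ ℕ, Nonempty ({a // k a = c} ≃ Fin ((expType k).count c)) := by
        intro k
        have e1 : {a // k a = c} ≃ {a // a ∈ k.support.filter (fun a => k a = c)} :=
          Equiv.subtypeEquivRight fun a => by
            simp only [Finset.mem_filter, Finsupp.mem_support_iff]
            exact ⟨fun h => ⟨h ▸ hc, h⟩, fun h => h.2⟩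
        have hcard : (k.support.filter (fun a => k a = c)).card = (expType k).count c := by
          unfold expType
          rw [Multiset.count_map, Finset.card_def, Finset.filter_val]
          simp [eq_comm]
        exact ⟨e1.trans (Finset.equivFinOfCardEq hcard)⟩
      obtain ⟨e1⟩ := aux m
      obtain ⟨e2⟩ := aux m'
      rw [h] at e1
      exact ⟨e1.trans e2.symm⟩
  exact ⟨Equiv.ofFiberEquiv fun c => (key c).some, fun i => Equiv.ofFiberEquiv_map _ i⟩

lemma coeff_rename_perm {K : Type*} [CommSemiring K] (e : Equiv.Perm ℕ) (m m' : ℕ →₀ ℕ)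
    (h : ∀ i, m' (e i) = m i) (f : MvPowerSeries ℕ K) :
    MvPowerSeries.coeff m' (MvPowerSeries.rename e f) = MvPowerSeries.coeff m f := by
  have : m' = Finsupp.embDomain e.toEmbedding m := by
    ext j
    obtain ⟨i, rfl⟩ := e.surjective j
    rw [h]
    exact (Finsupp.embDomain_apply_self e.toEmbedding m i).symm
  rw [this]
  exact MvPowerSeries.coeff_embDomain_rename e.toEmbedding f m

lemma coeff_eq_of_expType {K : Type*} [CommRing K] {f : MvPowerSeries ℕ K} (hf : f ∈ Sym K)
    {m m' : ℕ →₀ ℕ} (h : expType m = expType m') :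
    MvPowerSeries.coeff m f = MvPowerSeries.coeff m' f := by
  obtain ⟨e, he⟩ := exists_perm h
  rw [← coeff_rename_perm e m m' he f, hf.2 e]

lemma psumSeries_mem (K : Type*) [CommRing K] (k : ℕ) : psumSeries K k ∈ Sym K := by
  classical
  refine ⟨⟨k, fun m hm => ?_⟩, fun e => ?_⟩
  · rw [coeff_psumSeries, if_neg]
    rintro ⟨i, rfl⟩
    simp at hm
  · ext m
    rw [coeff_rename_perm e (m.embDomain e.symm.toEmbedding) m (fun i => ?_), coeff_psumSeries,
      coeff_psumSeries]
    · congr 1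
      refine propext ⟨?_, ?_⟩
      · rintro ⟨i, hi⟩
        refine ⟨e i, ?_⟩
        have := congrArg (Finsupp.embDomain e.toEmbedding) hi
        rw [← Finsupp.embDomain_trans_apply, Finsupp.embDomain_single] at this
        simpa using this
      · rintro ⟨i, rfl⟩
        exact ⟨e.symm i, by simp⟩
    · have := Finsupp.embDomain_apply_self e.symm.toEmbedding m (e i)
      simpa using this.symm

/-- The power-sum symmetric function `p_λ = ∏ᵢ p_{λᵢ}`. -/
def powerSum (K : Type*) [CommRing K] (lam : Σ n, Nat.Partition n) : Sym K :=
  ⟨psumProd K lam.2.parts, by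
    unfold psumProd
    refine Subalgebra.multiset_prod_mem _ fun f hf => ?_
    obtain ⟨k, -, rfl⟩ := Multiset.mem_map.1 hf
    exact psumSeries_mem K k⟩

lemma partition_ext {lam mu : Σ n, Nat.Partition n} (h : lam.2.parts = mu.2.parts) : lam = mu := by
  obtain ⟨n, l⟩ := lam
  obtain ⟨n', l'⟩ := mu
  have hn : n = n' := by rw [← l.parts_sum, ← l'.parts_sum]; exact congrArg Multiset.sum h
  subst hn
  exact Sigma.ext rfl (heq_of_eq (Nat.Partition.ext h))

lemma isUnit_coeff (K : Type*) [CommRing K] [Algebra ℚ K] {s : Multiset ℕ} {m : ℕ →₀ ℕ} (h : expType m = s) :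
    IsUnit (MvPowerSeries.coeff m (psumProd K s)) := by
  rw [coeff_psumProd_cast]
  have h0 : ((MvPowerSeries.coeff m (psumProd ℕ s) : ℕ) : ℚ) ≠ 0 :=
    Nat.cast_ne_zero.2 (coeff_psumProd_expType h)
  have := (IsUnit.mk0 _ h0).map (algebraMap ℚ K)
  simpa using this

lemma coeff_powerSum_eq_zero (K : Type*) [CommRing K] {lam : Σ n, Nat.Partition n} {m : ℕ →₀ ℕ}
    (h : m.degree ≠ lam.1 ∨ lam.2.parts.card < m.support.card ∨
      (lam.2.parts.card = m.support.card ∧ expType m ≠ lam.2.parts)) :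
    MvPowerSeries.coeff m (powerSum K lam : MvPowerSeries ℕ K) = 0 := by
  change MvPowerSeries.coeff m (psumProd K lam.2.parts) = 0
  rw [coeff_psumProd_cast]
  by_contra hne
  have hne' : MvPowerSeries.coeff m (psumProd ℕ lam.2.parts) ≠ 0 := fun h0 => hne (by simp [h0])
  have := coeff_psumProd_ne_zero (fun a ha => lam.2.parts_pos ha) hne'
  rcases h with h | h | ⟨h1, h2⟩
  · exact h (this.1.trans lam.2.parts_sum)
  · omega
  · exact h2 (this.2.2 h1.symm)

lemma powerSum_linearIndependent (K : Type*) [CommRing K] [Algebra ℚ K] : LinearIndependent K (powerSum K) := by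
  classical
  rw [linearIndependent_iff]
  intro c hc
  by_contra hne
  obtain ⟨lam, hlam, hmax⟩ := Finset.exists_max_image c.support (fun lam => lam.2.parts.card)
    (Finsupp.support_nonempty_iff.2 hne)
  obtain ⟨m, hm⟩ := exists_expType (s := lam.2.parts) (fun a ha => lam.2.parts_pos ha)
  have hcard : m.support.card = lam.2.parts.card := by rw [← hm]; simp [expType]
  have h1 := congrArg (fun f : Sym K => MvPowerSeries.coeff m (f : MvPowerSeries ℕ K)) hc
  simp only [Finsupp.linearCombination_apply, Finsupp.sum, AddSubmonoidClass.coe_finsetSum,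
    map_sum, ZeroMemClass.coe_zero, map_zero, Subalgebra.coe_smul, MvPowerSeries.coeff_smul] at h1
  rw [Finset.sum_eq_single lam] at h1
  · have := (isUnit_coeff K hm).mul_left_eq_zero.1 h1
    exact (Finsupp.mem_support_iff.1 hlam) this
  · intro mu hmu hne
    rw [coeff_powerSum_eq_zero K, mul_zero]
    rcases lt_or_eq_of_le (hmax mu hmu) with h | h
    · exact Or.inr (Or.inl (by omega))
    · exact Or.inr <| Or.inr ⟨by omega, fun h' => hne (partition_ext (by rw [← h', hm]))⟩
  · intro h; exact absurd hlam h

lemma mem_span_powerSum (K : Type*) [CommRing K] [Algebra ℚ K] (d k : ℕ) :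
    ∀ f : Sym K,
    (∀ m : ℕ →₀ ℕ, d < m.degree → MvPowerSeries.coeff m (f : MvPowerSeries ℕ K) = 0) →
    (∀ m : ℕ →₀ ℕ, k ≤ m.support.card → MvPowerSeries.coeff m (f : MvPowerSeries ℕ K) = 0) →
    f ∈ Submodule.span K (Set.range (powerSum K)) := by
  classical
  induction k with
  | zero =>
    intro f _ hf
    have : f = 0 := by
      apply Subtype.ext
      ext m
      exact hf m (Nat.zero_le _)
    rw [this]; exact Submodule.zero_mem _
  | succ k ih =>
    intro f hd hf
    choose μ hμ using fun lam : Σ n, Nat.Partition n =>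
      exists_expType (s := lam.2.parts) (fun a ha => lam.2.parts_pos ha)
    choose u hu using fun lam : Σ n, Nat.Partition n => isUnit_coeff K (hμ lam)
    set S : Finset (Σ n, Nat.Partition n) := (Finset.range (d + 1)).sigma
      (fun n => Finset.univ.filter (fun l : Nat.Partition n => l.parts.card = k)) with hS
    set c : (Σ n, Nat.Partition n) → K := fun lam =>
      MvPowerSeries.coeff (μ lam) (f : MvPowerSeries ℕ K) * ((u lam)⁻¹ : Kˣ) with hc
    set g : Sym K := ∑ lam ∈ S, c lam • powerSum K lam with hg
    have hgmem : g ∈ Submodule.span K (Set.range (powerSum K)) :=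
      Submodule.sum_mem _ fun lam _ =>
        Submodule.smul_mem _ _ (Submodule.subset_span ⟨lam, rfl⟩)
    have hgc : ∀ m, MvPowerSeries.coeff m (g : MvPowerSeries ℕ K) =
        ∑ lam ∈ S, c lam * MvPowerSeries.coeff m (powerSum K lam : MvPowerSeries ℕ K) := by
      intro m
      simp only [hg, AddSubmonoidClass.coe_finsetSum, map_sum, Subalgebra.coe_smul,
        MvPowerSeries.coeff_smul]
    have hcardS : ∀ lam ∈ S, lam.2.parts.card = k ∧ lam.1 ≤ d := by
      intro lam hlam
      rw [hS, Finset.mem_sigma, Finset.mem_filter, Finset.mem_range] at hlam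
      exact ⟨hlam.2.2, by omega⟩
    have hgd : ∀ m : ℕ →₀ ℕ, d < m.degree →
        MvPowerSeries.coeff m (g : MvPowerSeries ℕ K) = 0 := by
      intro m hdm
      rw [hgc]
      refine Finset.sum_eq_zero fun lam hlam => ?_
      have h2 := (hcardS lam hlam).2
      rw [coeff_powerSum_eq_zero K (Or.inl (by omega)), mul_zero]
    have hfg : f - g ∈ Submodule.span K (Set.range (powerSum K)) := by
      refine ih (f - g) (fun m hm => ?_) ?_
      · rw [AddSubgroupClass.coe_sub, map_sub, hd m hm, hgd m hm, sub_zero]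
      · intro m hm
        rw [AddSubgroupClass.coe_sub, map_sub, sub_eq_zero]
        rcases lt_or_ge d m.degree with hdm | hdm
        · rw [hd m hdm, hgd m hdm]
        rw [hgc]
        rcases lt_or_eq_of_le hm with h | h
        · rw [hf m h, Finset.sum_eq_zero]
          intro lam hlam
          rw [coeff_powerSum_eq_zero K (Or.inr (Or.inl (by rw [(hcardS lam hlam).1]; exact h))), mul_zero]
        · set lam : Σ n, Nat.Partition n := ⟨m.degree, ⟨expType m, expType_pos, expType_sum m⟩⟩
            with hlam
          have hmemS : lam ∈ S := by
            rw [hS, Finset.mem_sigma, Finset.mem_filter, Finset.mem_range]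
            refine ⟨by change m.degree < d + 1; omega, Finset.mem_univ _, ?_⟩
            rw [h]; exact Multiset.card_map _ _
          rw [Finset.sum_eq_single lam]
          · have h1 : MvPowerSeries.coeff m (powerSum K lam : MvPowerSeries ℕ K) = u lam := by
              rw [hu]
              exact coeff_eq_of_expType (powerSum K lam).2 (hμ lam).symm
            have h2 : MvPowerSeries.coeff m (f : MvPowerSeries ℕ K) =
                MvPowerSeries.coeff (μ lam) (f : MvPowerSeries ℕ K) :=
              coeff_eq_of_expType f.2 (hμ lam).symm
            rw [h1, h2, hc, Units.inv_mul_cancel_right]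
          · intro mu hmu hne
            rw [coeff_powerSum_eq_zero K (Or.inr (Or.inr ⟨by rw [(hcardS mu hmu).1]; exact h, ?_⟩)),
              mul_zero]
            intro h'
            exact hne (partition_ext h'.symm)
          · intro h'; exact absurd hmemS h'
    have := Submodule.add_mem _ hfg hgmem
    rwa [sub_add_cancel] at this

lemma span_powerSum_eq_top (K : Type*) [CommRing K] [Algebra ℚ K] :
    ⊤ ≤ Submodule.span K (Set.range (powerSum K)) := by
  rintro f -
  obtain ⟨d, hd⟩ := f.2.1
  refine mem_span_powerSum K d (d + 1) f hd fun m hm => hd m ?_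
  have h1 : m.support.card ≤ m.degree := by
    rw [Finset.card_eq_sum_ones]
    exact Finset.sum_le_sum fun i hi => Nat.one_le_iff_ne_zero.2 (Finsupp.mem_support_iff.1 hi)
  omega

/-- The power sums `p_λ`, for `λ` ranging over all partitions, form a basis of the ring of
symmetric functions over a `ℚ`-algebra. -/
def powerSumBasis (K : Type*) [CommRing K] [Algebra ℚ K] :
    Module.Basis (Σ n, Nat.Partition n) K (Sym K) :=
  Module.Basis.mk (powerSum_linearIndependent K) (span_powerSum_eq_top K)

/-- The scaling factor `z(λ) = ∏ᵢ i ^ mᵢ * mᵢ!`, where `mᵢ` is the number of parts of `λ` equal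
to `i`. -/
def zFactor (lam : Σ n, Nat.Partition n) : ℕ :=
  ∏ i ∈ lam.2.parts.toFinset, i ^ lam.2.parts.count i * (lam.2.parts.count i).factorial

/-- The Kronecker product of symmetric functions: the bilinear product with
`p_λ ⋆ p_λ = z(λ) p_λ` and `p_λ ⋆ p_μ = 0` for `λ ≠ μ`. -/
def kronecker (K : Type*) [CommRing K] [Algebra ℚ K] :
    Sym K →ₗ[K] Sym K →ₗ[K] Sym K :=
  (powerSumBasis K).constr K fun lam => (powerSumBasis K).constr K fun mu =>
    open Classical in if lam = mu then zFactor lam • powerSum K lam else 0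

lemma kronecker_powerSum (K : Type*) [CommRing K] [Algebra ℚ K] (lam mu : Σ n, Nat.Partition n) :
    kronecker K (powerSum K lam) (powerSum K mu) =
      open Classical in if lam = mu then zFactor lam • powerSum K lam else 0 := by
  have hb : ∀ l, powerSumBasis K l = powerSum K l := fun l => Module.Basis.mk_apply _ _ l
  unfold kronecker
  conv_lhs => rw [← hb lam, ← hb mu]
  rw [Module.Basis.constr_basis, Module.Basis.constr_basis]

end SymFun

end

noncomputable section

namespace Tymoczko

open MvPolynomial

/-! ### The big ring, its subrings and the dot action -/

/-- The ring `𝒯 = ∏_β ℂ[L₁, …, Lₙ]`, where `β` ranges over the bijections from the indeterminates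
`R₁, …, Rₙ` to the indeterminates `L₁, …, Lₙ`; such a bijection is encoded by the permutation of
the indices with `β(R_i) = L_{β i}`. -/
abbrev BigRing (n : ℕ) : Type := Equiv.Perm (Fin n) → MvPolynomial (Fin n) ℂ

/-- The polynomials `g_β(R₁, …, Rₙ)` in the presentation `x = ∑_β 1_β g_β(R₁, …, Rₙ)`: those with
`x_β(L₁, …, Lₙ) = g_β(β(R₁), …, β(Rₙ))`. -/
def rCoord {n : ℕ} (x : BigRing n) (β : Equiv.Perm (Fin n)) : MvPolynomial (Fin n) ℂ :=
  rename (β⁻¹ : Equiv.Perm (Fin n)) (x β)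

/-- The dot action of `w ∈ S_n`: `w • (f(L₁, …, Lₙ) 1_β) = f(L_{w 1}, …, L_{w n}) 1_{w ∘ β}`. -/
def dot (n : ℕ) : Representation ℂ (Equiv.Perm (Fin n)) (BigRing n) where
  toFun w :=
    { toFun := fun x β => rename w (x (w⁻¹ * β))
      map_add' := fun x y => by ext1 β; simp
      map_smul' := fun c x => by ext1 β; simp }
  map_one' := by
    refine LinearMap.ext fun x => funext fun β => ?_
    simp
  map_mul' v w := by
    refine LinearMap.ext fun x => funext fun β => ?_
    simp [rename_rename, mul_assoc, Equiv.Perm.coe_mul]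

/-- `ℂ[L]` as a subring of `𝒯`: the constant families. -/
def polyL (n : ℕ) : Subalgebra ℂ (BigRing n) :=
  (Pi.constAlgHom ℂ (Equiv.Perm (Fin n)) (MvPolynomial (Fin n) ℂ)).range

/-- `ℂ[R]` as a subring of `𝒯`: since `R_i 1_β = β(R_i) 1_β`, the polynomial `g(R₁, …, Rₙ)` has
coordinate `g(β(R₁), …, β(Rₙ))` at `β`. -/
def polyR (n : ℕ) : Subalgebra ℂ (BigRing n) :=
  (AlgHom.pi fun β : Equiv.Perm (Fin n) =>
    (rename β : MvPolynomial (Fin n) ℂ →ₐ[ℂ] MvPolynomial (Fin n) ℂ)).range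

/-- A Hessenberg function `h : [n] → [n]`. -/
structure HessenbergFunction (n : ℕ) where
  toFun : Fin n → Fin n
  extensive : ∀ i, i ≤ toFun i
  increasing : Monotone toFun

/-- Adjacency in the moment graph `M(h)`: there is a directed edge labelled `(R_i, R_j)` from `β`
to `β ∘ (R_i ↔ R_j)` when `i < j ≤ h(i)` and `(R_i, R_j)` is not an inversion of `β`. -/
def IsEdge {n : ℕ} (h : HessenbergFunction n) (i j : Fin n) (β β' : Equiv.Perm (Fin n)) : Prop :=
  i < j ∧ j ≤ h.toFun i ∧ β i < β j ∧ β' = β * Equiv.swap i j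

/-- The ring `𝒯_h` of the elements of `𝒯` which satisfy the edge conditions for all edges of the
moment graph `M(h)`: for an edge `β → β'` labelled `(R_i, R_j)`, the difference `g_β - g_β'` is
divisible by `R_i - R_j`. -/
def tymoczkoRing {n : ℕ} (h : HessenbergFunction n) : Subalgebra ℂ (BigRing n) where
  carrier := {x | ∀ i j β β', IsEdge h i j β β' →
    (X i - X j : MvPolynomial (Fin n) ℂ) ∣ rCoord x β - rCoord x β'}
  mul_mem' := by
    intro x y hx hy i j β β' e
    have h1 : rCoord (x * y) β - rCoord (x * y) β' =
        (rCoord x β - rCoord x β') * rCoord y β + rCoord x β' * (rCoord y β - rCoord y β') := by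
      simp only [rCoord, Pi.mul_apply, map_mul]; ring
    rw [h1]
    exact dvd_add (Dvd.dvd.mul_right (hx i j β β' e) _) (Dvd.dvd.mul_left (hy i j β β' e) _)
  add_mem' := by
    intro x y hx hy i j β β' e
    have h1 : rCoord (x + y) β - rCoord (x + y) β' =
        (rCoord x β - rCoord x β') + (rCoord y β - rCoord y β') := by
      simp only [rCoord, Pi.add_apply, map_add]; ring
    rw [h1]
    exact dvd_add (hx i j β β' e) (hy i j β β' e)
  algebraMap_mem' := by
    intro c i j β β' _
    simp [rCoord]

lemma X_sub_X_dvd {n : ℕ} (i j : Fin n) (p : MvPolynomial (Fin n) ℂ) :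
    (X i - X j : MvPolynomial (Fin n) ℂ) ∣ p - rename (Equiv.swap i j) p := by
  induction p using MvPolynomial.induction_on with
  | C a => simp
  | add p q hp hq =>
    have h1 : p + q - rename (Equiv.swap i j) (p + q) =
      (p - rename (Equiv.swap i j) p) + (q - rename (Equiv.swap i j) q) := by
      rw [map_add]; ring
    rw [h1]; exact dvd_add hp hq
  | mul_X p k hp =>
    have h1 : p * X k - rename (Equiv.swap i j) (p * X k) =
      (p - rename (Equiv.swap i j) p) * X k +
        rename (Equiv.swap i j) p * (X k - X (Equiv.swap i j k)) := by
      rw [map_mul, rename_X]; ring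
    rw [h1]
    refine dvd_add (Dvd.dvd.mul_right hp _) (Dvd.dvd.mul_left ?_ _)
    by_cases hi : k = i
    · subst hi; simp
    · by_cases hj : k = j
      · subst hj; rw [Equiv.swap_apply_right]; exact ⟨-1, by ring⟩
      · rw [Equiv.swap_apply_of_ne_of_ne hi hj, sub_self]; exact dvd_zero _

lemma polyL_le {n : ℕ} (h : HessenbergFunction n) : polyL n ≤ tymoczkoRing h := by
  rintro _ ⟨f, rfl⟩ i j β β' ⟨-, -, -, rfl⟩
  have h1 : rCoord (Pi.constAlgHom ℂ (Equiv.Perm (Fin n)) (MvPolynomial (Fin n) ℂ) f)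
      (β * Equiv.swap i j) = rename (Equiv.swap i j) (rename (β⁻¹ : Equiv.Perm (Fin n)) f) := by
    rw [rename_rename, rCoord, mul_inv_rev, Equiv.swap_inv, Equiv.Perm.coe_mul]; rfl
  change _ ∣ _ - rCoord (Pi.constAlgHom ℂ (Equiv.Perm (Fin n)) (MvPolynomial (Fin n) ℂ) f) _
  rw [h1]
  exact X_sub_X_dvd i j _

lemma rCoord_polyR {n : ℕ} (f : MvPolynomial (Fin n) ℂ) (β : Equiv.Perm (Fin n)) :
    rCoord (fun β : Equiv.Perm (Fin n) => rename β f) β = f := by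
  rw [rCoord, rename_rename, ← Equiv.Perm.coe_mul, inv_mul_cancel, Equiv.Perm.coe_one, rename_id,
    AlgHom.id_apply]

lemma polyR_le {n : ℕ} (h : HessenbergFunction n) : polyR n ≤ tymoczkoRing h := by
  rintro _ ⟨f, rfl⟩ i j β β' -
  change _ ∣ rCoord (fun β : Equiv.Perm (Fin n) => rename β f) β -
    rCoord (fun β : Equiv.Perm (Fin n) => rename β f) β'
  rw [rCoord_polyR, rCoord_polyR, sub_self]
  exact dvd_zero _

/-- `𝒯_h` as a module (algebra) over its subring `ℂ[L]`. -/
instance algebraPolyL {n : ℕ} (h : HessenbergFunction n) : Algebra (polyL n) (tymoczkoRing h) :=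
  (Subalgebra.inclusion (polyL_le h)).toRingHom.toAlgebra

/-- `𝒯_h` as a module (algebra) over its subring `ℂ[R]`. -/
instance algebraPolyR {n : ℕ} (h : HessenbergFunction n) : Algebra (polyR n) (tymoczkoRing h) :=
  (Subalgebra.inclusion (polyR_le h)).toRingHom.toAlgebra

lemma rCoord_dot {n : ℕ} (w : Equiv.Perm (Fin n)) (x : BigRing n) (β : Equiv.Perm (Fin n)) :
    rCoord (dot n w x) β = rCoord x (w⁻¹ * β) := by
  change rename _ (rename w (x (w⁻¹ * β))) = rename _ _
  rw [rename_rename, ← Equiv.Perm.coe_mul, mul_inv_rev, inv_inv]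

lemma dot_mem_tymoczkoRing {n : ℕ} (h : HessenbergFunction n) (w : Equiv.Perm (Fin n)) :
    ∀ x ∈ tymoczkoRing h, dot n w x ∈ tymoczkoRing h := by
  rintro x hx i j β β' ⟨hij, hj, -, rfl⟩
  rw [rCoord_dot, rCoord_dot, ← mul_assoc]
  rcases lt_trichotomy ((w⁻¹ * β) i) ((w⁻¹ * β) j) with hlt | heq | hgt
  · exact hx i j _ _ ⟨hij, hj, hlt, rfl⟩
  · exact absurd ((w⁻¹ * β).injective heq) hij.ne
  · rw [dvd_sub_comm]
    refine hx i j _ _ ⟨hij, hj, ?_, ?_⟩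
    · simpa using hgt
    · rw [mul_assoc, Equiv.swap_mul_self, mul_one]

lemma dot_mem_polyL {n : ℕ} (w : Equiv.Perm (Fin n)) :
    ∀ x ∈ polyL n, dot n w x ∈ polyL n := by
  rintro _ ⟨f, rfl⟩
  exact ⟨rename w f, rfl⟩

lemma dot_mem_polyR {n : ℕ} (w : Equiv.Perm (Fin n)) :
    ∀ x ∈ polyR n, dot n w x ∈ polyR n := by
  rintro _ ⟨f, rfl⟩
  refine ⟨f, funext fun β => ?_⟩
  change rename β f = rename w (rename (w⁻¹ * β : Equiv.Perm (Fin n)) f)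
  rw [rename_rename, ← Equiv.Perm.coe_mul, mul_inv_cancel_left]

/-- The dot action on a stable subring of `𝒯`. -/
def dotOn {n : ℕ} (M : Subalgebra ℂ (BigRing n)) (hM : ∀ w, ∀ x ∈ M, dot n w x ∈ M) :
    Representation ℂ (Equiv.Perm (Fin n)) M where
  toFun w :=
    { toFun := fun x => ⟨dot n w x, hM w x x.2⟩
      map_add' := fun x y => Subtype.ext (map_add (dot n w) x.1 y.1)
      map_smul' := fun c x => Subtype.ext (map_smul (dot n w) c x.1) }
  map_one' := LinearMap.ext fun x => Subtype.ext (by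
    change dot n 1 x.1 = x.1
    rw [map_one]; rfl)
  map_mul' v w := LinearMap.ext fun x => Subtype.ext (by
    change dot n (v * w) x.1 = dot n v (dot n w x.1)
    rw [map_mul]; rfl)

/-- The dot action of `S_n` on `𝒯_h`. -/
def dotT {n : ℕ} (h : HessenbergFunction n) :
    Representation ℂ (Equiv.Perm (Fin n)) (tymoczkoRing h) :=
  dotOn (tymoczkoRing h) (dot_mem_tymoczkoRing h)

/-- The dot action of `S_n` on `ℂ[L]`, which permutes the indeterminates. -/
def dotL (n : ℕ) : Representation ℂ (Equiv.Perm (Fin n)) (polyL n) :=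
  dotOn (polyL n) dot_mem_polyL

/-- The dot action of `S_n` on `ℂ[R]`, which is trivial. -/
def dotR (n : ℕ) : Representation ℂ (Equiv.Perm (Fin n)) (polyR n) :=
  dotOn (polyR n) dot_mem_polyR

/-- The degree `d` part of a subring of `𝒯`: all coordinates are homogeneous of degree `d`. -/
def gradedPart {n : ℕ} (M : Subalgebra ℂ (BigRing n)) (d : ℕ) : Submodule ℂ M where
  carrier := {x | ∀ β, (x.1 β).IsHomogeneous d}
  add_mem' := fun hx hy β => (hx β).add (hy β)
  zero_mem' := fun _ => isHomogeneous_zero _ _ _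
  smul_mem' := fun c x hx β => by
    change (c • x.1 β).IsHomogeneous d
    rw [smul_eq_C_mul]
    simpa using (isHomogeneous_C (Fin n) c).mul (hx β)

/-! ### Graded traces and graded Frobenius characteristics -/

/-- A basis of `M` over `A` which consists of homogeneous elements for the grading `𝓜`. -/
structure HomogeneousBasis (A : Type) {M : Type} [CommRing A] [AddCommGroup M] [Module ℂ M]
    [Module A M] (𝓜 : ℕ → Submodule ℂ M) where
  ι : Type
  basis : Module.Basis ι A M
  deg : ι → ℕ
  homogeneous : ∀ i, basis i ∈ 𝓜 (deg i)

variable {A M : Type} [CommRing A] [Algebra ℂ A] [AddCommGroup M] [Module ℂ M] [Module A M]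
  {𝓜 : ℕ → Submodule ℂ M}

/-- The coefficient of `e_i` in `φ(e_i)`, an element of `A`. -/
def HomogeneousBasis.diagCoeff (e : HomogeneousBasis A 𝓜) (φ : M →ₗ[ℂ] M) (i : e.ι) : A :=
  e.basis.repr (φ (e.basis i)) i

/-- The graded trace `∑_i q ^ deg(e_i) (coefficient of e_i in φ(e_i)) ∈ ℂ⟦q⟧` with respect to a
homogeneous basis; the coefficients are scalars in `ℂ ⊆ A`. -/
def HomogeneousBasis.trace (e : HomogeneousBasis A 𝓜) (φ : M →ₗ[ℂ] M) : PowerSeries ℂ :=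
  PowerSeries.mk fun d =>
    ∑ᶠ i ∈ {i | e.deg i = d}, Function.invFun (algebraMap ℂ A) (e.diagCoeff φ i)

variable (A 𝓜) in
/-- The graded trace of `φ` over `A` is well defined: there is a homogeneous basis, and for each
such basis the coefficients are scalars, each degree has finitely many basis elements, and the
result does not depend on the basis. -/
structure HasGradedTrace (φ : M →ₗ[ℂ] M) : Prop where
  exists_basis : Nonempty (HomogeneousBasis A 𝓜)
  scalar : ∀ (e : HomogeneousBasis A 𝓜) (i : e.ι), ∃ c : ℂ, algebraMap ℂ A c = e.diagCoeff φ i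
  finite : ∀ (e : HomogeneousBasis A 𝓜) (d : ℕ), {i | e.deg i = d}.Finite
  unique : ∀ e e' : HomogeneousBasis A 𝓜, e.trace φ = e'.trace φ

variable (A 𝓜) in
/-- The graded trace `tr_q(φ, M, A)`. -/
def gradedTrace (φ : M →ₗ[ℂ] M) : PowerSeries ℂ :=
  open Classical in if H : Nonempty (HomogeneousBasis A 𝓜) then H.some.trace φ else 0

variable (A 𝓜) in
/-- The graded Frobenius characteristic
`frob_q(S_n, M, A) = (1 / n!) ∑_w tr_q(w, M, A) p_{cycle type of w}`. -/
def gradedFrob {n : ℕ} (ρ : Representation ℂ (Equiv.Perm (Fin n)) M) :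
    SymFun.Sym (PowerSeries ℂ) :=
  PowerSeries.C ((n.factorial : ℂ)⁻¹) • ∑ w : Equiv.Perm (Fin n),
    gradedTrace A 𝓜 (ρ w) • SymFun.powerSum (PowerSeries ℂ) ⟨_, w.partition⟩

end Tymoczko

end

open Tymoczko SymFun

/-!
The point is that `𝒯_h` is free over `ℂ[L]` and over `ℂ[R]`, with the same homogeneous basis for
both. In the coordinates `g_β ∈ ℂ[R]`, the ring `𝒯_h` consists of the splines on the symmetric
group: `X a - X b` divides `g_β - g_{β ∘ (a b)}` whenever `a < b ≤ h a`. For the lexicographic order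
on permutations, a flow-up spline at `v` vanishes at all `u < v` and its value at `v` is the product
of the labels `X a - X b` of the edges that lead from `v` to smaller permutations. Since these
labels are distinct primes, this product divides the value at `v` of every spline that vanishes
below `v` (`leadingTerm_dvd`). As both `ℂ[L]` and `ℂ[R]` are identified with the whole polynomial
ring by each coordinate, a family of flow-up splines is a basis over either of them, by
triangularity (`linearIndependent_of_triangular`, `span_eq_top_of_triangular`).

Flow-up splines exist by induction on the number of pairs `a < b ≤ h a` (`exists_isFlowUp`). Let
`i` be minimal among the left ends of these pairs and let `j = h i`; removing `(i, j)` leaves a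
smaller set of pairs of the same kind, with flow-up splines `p_v`. If `v j < v i`, then
`(X i - X j) p_v` is a flow-up spline at `v` for the larger set. If `v i < v j`, the leading term
does not change, but the differences `g_w - g_{w ∘ (i j)}` of `g = p_v` modulo `X i - X j` have to
be removed. This is done by subtracting multiples of `p_u` for `u > v` with `u j < u i`, in increasing
order of `u`. It works since the first nonvanishing difference, at `u`, is divisible by the leading
term of `p_u` modulo `X i - X j` (`IsExtremalEdge.collapse_leadingTerm_dvd`). Modulo `X i - X j` the
labels of `(i, k)` and `(k, j)` become equal up to sign, and the divisibility by the square of this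
prime comes from the hexagon of the permutations of three positions.

The part of degree `d` is the `2 ^ d`-eigenspace of the substitution `X k ↦ 2 X k`, from which it
follows that the diagonal coefficients in homogeneous bases are scalars, and that over `ℂ` the
graded trace is the generating function of the traces on the parts of fixed degree. For a graded
ring `A ⊆ 𝒯_h`, the products of a homogeneous basis of `A` over `ℂ` and one of `𝒯_h` over `A` form a
homogeneous basis of `𝒯_h` over `ℂ`, and so the trace over `ℂ` is the product of the trace over `A`
and the trace on `A` (`hasGradedTrace_and_gradedTrace_eq_mul`). The trace on `A` has a nonzero
constant term, hence can be cancelled, and the trace over `A` is also independent of the basis.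
Finally, the Kronecker product of Frobenius characteristics corresponds to the pointwise product of
class functions (`kronecker_sum_powerSum`).
-/

namespace Tymoczko

open MvPolynomial

/-! ### Differences of indeterminates -/

section Collapse

variable {σ K : Type*} [Field K]

lemma X_sub_X_ne_zero {i j : σ} (h : i ≠ j) : (X i - X j : MvPolynomial σ K) ≠ 0 :=
  sub_ne_zero.2 fun h' => h (X_injective h')

variable [DecidableEq σ]

/-- The substitution `X j ↦ X i`, whose kernel is generated by `X i - X j`. -/
noncomputable def collapse (K : Type*) [Field K] (i j : σ) :
    MvPolynomial σ K →ₐ[K] MvPolynomial σ K :=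
  rename (Function.update id j i)

lemma collapse_X (i j k : σ) : collapse K i j (X k) = X (Function.update id j i k) :=
  rename_X _ _

lemma collapse_X_of_ne {i j k : σ} (h : k ≠ j) : collapse K i j (X k) = X k := by
  rw [collapse_X, Function.update_of_ne h, id]

lemma collapse_X_self (i j : σ) : collapse K i j (X j) = X i := by
  rw [collapse_X, Function.update_self]

lemma X_sub_X_dvd_sub_collapse (i j : σ) (p : MvPolynomial σ K) :
    X i - X j ∣ p - collapse K i j p := by
  induction p using MvPolynomial.induction_on with
  | C a => simp [collapse]
  | add p q hp hq =>
    rw [map_add, add_sub_add_comm]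
    exact dvd_add hp hq
  | mul_X p k hp =>
    have h : p * X k - collapse K i j (p * X k) = (p - collapse K i j p) * X k +
        collapse K i j p * (X k - collapse K i j (X k)) := by
      rw [map_mul]; ring
    rw [h]
    refine dvd_add (hp.mul_right _) (Dvd.dvd.mul_left ?_ _)
    by_cases hk : k = j
    · subst hk
      rw [collapse_X_self]
      exact ⟨-1, by ring⟩
    · rw [collapse_X_of_ne hk, sub_self]
      exact dvd_zero _

lemma X_sub_X_dvd_iff {i j : σ} {p : MvPolynomial σ K} :
    X i - X j ∣ p ↔ collapse K i j p = 0 := by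
  refine ⟨?_, fun h => by simpa [h] using X_sub_X_dvd_sub_collapse i j p⟩
  rintro ⟨q, rfl⟩
  rw [map_mul, map_sub, collapse_X_self]
  by_cases hij : i = j
  · subst hij; simp [collapse_X_self]
  · rw [collapse_X_of_ne hij, sub_self, zero_mul]

lemma collapse_idem (i j : σ) (p : MvPolynomial σ K) :
    collapse K i j (collapse K i j p) = collapse K i j p := by
  have h := X_sub_X_dvd_iff.1 (X_sub_X_dvd_sub_collapse i j p)
  rw [map_sub, sub_eq_zero] at h
  exact h.symm

lemma prime_X_sub_X {i j : σ} (h : i ≠ j) : Prime (X i - X j : MvPolynomial σ K) := by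
  refine ⟨X_sub_X_ne_zero h, fun hu => ?_, fun p q hpq => ?_⟩
  · have h1 := X_sub_X_dvd_iff.1 (hu.dvd (a := (1 : MvPolynomial σ K)))
    rw [map_one] at h1
    exact one_ne_zero h1
  · simpa only [X_sub_X_dvd_iff, map_mul, mul_eq_zero] using hpq

lemma isRelPrime_X_sub_X {a b c d : σ} (hab : a ≠ b) (hcd : c ≠ d) (h1 : ¬(a = c ∧ b = d))
    (h2 : ¬(a = d ∧ b = c)) : IsRelPrime (X a - X b : MvPolynomial σ K) (X c - X d) := by
  rw [(prime_X_sub_X hab).irreducible.isRelPrime_iff_not_dvd, X_sub_X_dvd_iff, map_sub,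
    sub_eq_zero, collapse_X, collapse_X]
  intro h
  have h' := X_injective h
  by_cases hc : c = b
  · subst hc
    rw [Function.update_self, Function.update_of_ne hcd.symm] at h'
    exact h2 ⟨h', rfl⟩
  · rw [Function.update_of_ne hc] at h'
    by_cases hd : d = b
    · subst hd
      rw [Function.update_self] at h'
      exact h1 ⟨h'.symm, rfl⟩
    · rw [Function.update_of_ne hd] at h'
      exact hcd h'

lemma X_sub_X_dvd_homogeneousComponent {i j : σ} {p : MvPolynomial σ K} (h : X i - X j ∣ p)
    (d : ℕ) : X i - X j ∣ homogeneousComponent d p := by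
  rw [X_sub_X_dvd_iff, collapse] at h ⊢
  rw [rename_homogeneousComponent, h, map_zero]

end Collapse

/-! ### The lexicographic order on permutations -/

/-- The lexicographic order on the words `v 0, v 1, …`. -/
noncomputable instance permLexOrder (n : ℕ) : LinearOrder (Equiv.Perm (Fin n)) :=
  LinearOrder.lift' (fun v => toLex (v : Fin n → Fin n))
    fun _ _ h => DFunLike.coe_injective (toLex.injective h)

lemma perm_lt_of_apply_lt {n : ℕ} {u v : Equiv.Perm (Fin n)} {a : Fin n}
    (h : ∀ c < a, u c = v c) (ha : u a < v a) : u < v :=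
  ⟨a, h, ha⟩

lemma mul_swap_lt {n : ℕ} {v : Equiv.Perm (Fin n)} {a b : Fin n} (hab : a < b)
    (hv : v b < v a) : v * Equiv.swap a b < v := by
  refine perm_lt_of_apply_lt (a := a) (fun c hc => ?_) ?_
  · rw [Equiv.Perm.mul_apply, Equiv.swap_apply_of_ne_of_ne hc.ne (hc.trans hab).ne]
  · rwa [Equiv.Perm.mul_apply, Equiv.swap_apply_left]

/-! ### Splines on the symmetric group -/

section Spline

variable {n : ℕ} {K : Type*} [Field K]

/-- The families of polynomials `g_β`, indexed by permutations `β`, such that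
`g_β - g_{β ∘ (a b)}` is divisible by `X a - X b` for all `β` and all `(a, b)` in the set `E`. -/
def splines (K : Type*) [Field K] (E : Finset (Fin n × Fin n)) :
    Submodule (MvPolynomial (Fin n) K) (Equiv.Perm (Fin n) → MvPolynomial (Fin n) K) where
  carrier := {g | ∀ a b, (a, b) ∈ E → ∀ β : Equiv.Perm (Fin n),
    X a - X b ∣ g β - g (β * Equiv.swap a b)}
  add_mem' := by
    intro f g hf hg a b hab β
    rw [Pi.add_apply, Pi.add_apply, add_sub_add_comm]
    exact dvd_add (hf a b hab β) (hg a b hab β)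
  zero_mem' := by
    intro a b _ β
    rw [Pi.zero_apply, Pi.zero_apply, sub_zero]
    exact dvd_zero _
  smul_mem' := by
    intro c g hg a b hab β
    rw [Pi.smul_apply, Pi.smul_apply, ← smul_sub, smul_eq_mul]
    exact (hg a b hab β).mul_left c

/-- A set of pairs `a < b` which is closed under passing to smaller intervals; these are the sets
`{(a, b) | a < b ≤ h a}` for Hessenberg functions `h`. -/
def IsIntervalClosed (E : Finset (Fin n × Fin n)) : Prop :=
  (∀ a b, (a, b) ∈ E → a < b) ∧
    ∀ a b, (a, b) ∈ E → ∀ c d, a ≤ c → c < d → d ≤ b → (c, d) ∈ E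

/-- The pairs in `E` which are inversions of `v`. -/
def inversions (E : Finset (Fin n × Fin n)) (v : Equiv.Perm (Fin n)) :
    Finset (Fin n × Fin n) :=
  E.filter fun p => v p.2 < v p.1

lemma mem_inversions {E : Finset (Fin n × Fin n)} {v : Equiv.Perm (Fin n)}
    {p : Fin n × Fin n} : p ∈ inversions E v ↔ p ∈ E ∧ v p.2 < v p.1 :=
  Finset.mem_filter

/-- The product of the labels of the edges from `v` to lexicographically smaller permutations. -/
noncomputable def leadingTerm (K : Type*) [Field K] (E : Finset (Fin n × Fin n))
    (v : Equiv.Perm (Fin n)) : MvPolynomial (Fin n) K :=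
  ∏ p ∈ inversions E v, (X p.1 - X p.2)

lemma leadingTerm_ne_zero {E : Finset (Fin n × Fin n)} (hE : IsIntervalClosed E)
    (v : Equiv.Perm (Fin n)) : leadingTerm K E v ≠ 0 :=
  Finset.prod_ne_zero_iff.2 fun p hp =>
    X_sub_X_ne_zero (hE.1 p.1 p.2 (mem_inversions.1 hp).1).ne

lemma leadingTerm_isHomogeneous (E : Finset (Fin n × Fin n)) (v : Equiv.Perm (Fin n)) :
    (leadingTerm K E v).IsHomogeneous (inversions E v).card := by
  rw [Finset.card_eq_sum_ones]
  exact IsHomogeneous.prod _ _ _ fun p _ => (isHomogeneous_X K p.1).sub (isHomogeneous_X K p.2)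

lemma leadingTerm_dvd {E : Finset (Fin n × Fin n)} (hE : IsIntervalClosed E)
    {v : Equiv.Perm (Fin n)} {g : Equiv.Perm (Fin n) → MvPolynomial (Fin n) K}
    (hg : g ∈ splines K E) (hv : ∀ u < v, g u = 0) : leadingTerm K E v ∣ g v := by
  refine Finset.prod_dvd_of_isRelPrime ?_ fun p hp => ?_
  · intro p hp q hq hpq
    have hp' := hE.1 p.1 p.2 (mem_inversions.1 hp).1
    have hq' := hE.1 q.1 q.2 (mem_inversions.1 hq).1
    refine isRelPrime_X_sub_X hp'.ne hq'.ne (fun h => hpq (Prod.ext h.1 h.2)) fun h => ?_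
    rw [h.1, h.2] at hp'
    exact hp'.asymm hq'
  · obtain ⟨hpE, hpv⟩ := mem_inversions.1 hp
    have h := hg p.1 p.2 hpE v
    rwa [hv _ (mul_swap_lt (hE.1 p.1 p.2 hpE) hpv), sub_zero] at h

/-- The difference `g_w - g_{w ∘ (i j)}` modulo `X i - X j`. -/
noncomputable def edgeDefect (i j : Fin n) (g : Equiv.Perm (Fin n) → MvPolynomial (Fin n) K)
    (w : Equiv.Perm (Fin n)) : MvPolynomial (Fin n) K :=
  collapse K i j (g w - g (w * Equiv.swap i j))

lemma edgeDefect_mul_swap (i j : Fin n) (g : Equiv.Perm (Fin n) → MvPolynomial (Fin n) K)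
    (w : Equiv.Perm (Fin n)) : edgeDefect i j g (w * Equiv.swap i j) = -edgeDefect i j g w := by
  rw [edgeDefect, edgeDefect, mul_assoc, Equiv.swap_mul_self, mul_one, ← map_neg, neg_sub]

variable {i j k : Fin n} {E : Finset (Fin n × Fin n)} {u : Equiv.Perm (Fin n)}
  {g : Equiv.Perm (Fin n) → MvPolynomial (Fin n) K}

/-- The edge defect is congruent along edges that are disjoint from `{i, j}`. -/
lemma dvd_edgeDefect_of_disjoint (hg : g ∈ splines K E)
    {a b : Fin n} (hab : (a, b) ∈ E) (hai : a ≠ i) (haj : a ≠ j) (hbi : b ≠ i) (hbj : b ≠ j)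
    (hu : edgeDefect i j g (u * Equiv.swap a b) = 0) : X a - X b ∣ edgeDefect i j g u := by
  have h1 := map_dvd (collapse K i j) (hg a b hab u)
  have h2 := map_dvd (collapse K i j) (hg a b hab (u * Equiv.swap i j))
  rw [map_sub (collapse K i j) (X a), collapse_X_of_ne haj, collapse_X_of_ne hbj] at h1 h2
  have hcomm : Equiv.swap i j * Equiv.swap a b = Equiv.swap a b * Equiv.swap i j := by
    rw [Equiv.mul_swap_eq_swap_mul, Equiv.swap_apply_of_ne_of_ne hai haj,
      Equiv.swap_apply_of_ne_of_ne hbi hbj]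
  rw [mul_assoc, hcomm, ← mul_assoc] at h2
  have h3 := dvd_sub h1 h2
  rw [← map_sub, sub_sub_sub_comm, map_sub] at h3
  change _ ∣ edgeDefect i j g u - edgeDefect i j g (u * Equiv.swap a b) at h3
  rwa [hu, sub_zero] at h3

/-- If `(i, k)` and `(k, j)` are edges, then the path `(i j) = (i k) (k j) (i k)` shows that the
edge defect vanishes modulo `X i - X k`. -/
lemma dvd_edgeDefect_of_between (hg : g ∈ splines K E) (hik : (i, k) ∈ E) (hkj : (k, j) ∈ E)
    (hkj' : k ≠ j) (hij : i ≠ j) : X i - X k ∣ edgeDefect i j g u := by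
  have e : u * Equiv.swap i k * Equiv.swap k j * Equiv.swap i k = u * Equiv.swap i j := by
    rw [mul_assoc u, Equiv.mul_swap_eq_swap_mul (Equiv.swap i k), Equiv.swap_apply_right,
      Equiv.swap_apply_of_ne_of_ne hij.symm hkj'.symm, mul_assoc, Equiv.mul_swap_mul_self]
  have h1 := map_dvd (collapse K i j) (hg i k hik u)
  have h2 := map_dvd (collapse K i j) (hg k j hkj (u * Equiv.swap i k))
  have h3 := map_dvd (collapse K i j) (hg i k hik (u * Equiv.swap i k * Equiv.swap k j))
  rw [e] at h3
  rw [map_sub (collapse K i j) (X i), collapse_X_of_ne hij, collapse_X_of_ne hkj'] at h1 h3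
  rw [map_sub (collapse K i j) (X k), collapse_X_self, collapse_X_of_ne hkj', ← neg_sub,
    neg_dvd] at h2
  have h := dvd_add (dvd_add h1 h2) h3
  rwa [← map_add, ← map_add, sub_add_sub_cancel, sub_add_sub_cancel] at h

/-- If `(i, k)` and `(k, j)` are edges, then an alternating sum over the hexagon which they span
is divisible by both labels. -/
lemma mul_dvd_edgeDefect_of_between (hg : g ∈ splines K E) (hik : (i, k) ∈ E) (hkj : (k, j) ∈ E)
    (hik' : i ≠ k) (hkj' : k ≠ j) (hij : i ≠ j)
    (h1 : edgeDefect i j g (u * Equiv.swap i k) = 0)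
    (h2 : edgeDefect i j g (u * Equiv.swap k j) = 0) :
    collapse K i j ((X i - X k) * (X k - X j)) ∣ edgeDefect i j g u := by
  set s := Equiv.swap i k with hs
  set t := Equiv.swap k j with ht
  set r := Equiv.swap i j with hr
  have e1 : r * s = t * r := by
    rw [hs, Equiv.mul_swap_eq_swap_mul, hr, Equiv.swap_apply_left,
      Equiv.swap_apply_of_ne_of_ne hik'.symm hkj', Equiv.swap_comm j k]
  have e2 : t * s = r * t := by
    rw [hs, Equiv.mul_swap_eq_swap_mul, ht, Equiv.swap_apply_left,
      Equiv.swap_apply_of_ne_of_ne hik' hij]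
  have e3 : s * r = t * s := by
    rw [hr, Equiv.mul_swap_eq_swap_mul, hs, Equiv.swap_apply_left,
      Equiv.swap_apply_of_ne_of_ne hij.symm hkj'.symm]
  have e4 : s * t = r * s := by
    rw [ht, Equiv.mul_swap_eq_swap_mul, hs, Equiv.swap_apply_right,
      Equiv.swap_apply_of_ne_of_ne hij.symm hkj'.symm]
  have hx : X i - X k ∣ (g u - g (u * r)) - (g (u * s) - g (u * s * r)) -
      (g (u * t) - g (u * t * r)) := by
    have a1 := hg i k hik u
    have a2 := hg i k hik (u * r)
    have a3 := hg i k hik (u * t)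
    rw [← hs] at a1 a2 a3
    rw [mul_assoc u r s, e1, ← mul_assoc] at a2
    rw [mul_assoc u t s, ← e3, ← mul_assoc] at a3
    convert dvd_sub (dvd_sub a1 a2) a3 using 1
    ring
  have hy : X k - X j ∣ (g u - g (u * r)) - (g (u * s) - g (u * s * r)) -
      (g (u * t) - g (u * t * r)) := by
    have a1 := hg k j hkj u
    have a2 := hg k j hkj (u * r)
    have a3 := hg k j hkj (u * s)
    rw [← ht] at a1 a2 a3
    rw [mul_assoc u r t, ← e2, ← e3, ← mul_assoc] at a2
    rw [mul_assoc u s t, e4, e1, ← mul_assoc] at a3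
    convert dvd_sub (dvd_sub a1 a2) a3 using 1
    ring
  have h := map_dvd (collapse K i j) ((isRelPrime_X_sub_X (K := K) hik' hkj'
    (fun h => hik' h.1) (fun h => hij h.1)).mul_dvd hx hy)
  rw [map_sub (collapse K i j), map_sub (collapse K i j)] at h
  change _ ∣ edgeDefect i j g u - edgeDefect i j g (u * s) - edgeDefect i j g (u * t) at h
  rwa [h1, h2, sub_zero, sub_zero] at h

/-- If `(j, k)` is an edge, then the edge defect at `u` is congruent to a combination of edge
defects at two other permutations. -/
lemma dvd_edgeDefect_of_right (hg : g ∈ splines K E) (hjk : (j, k) ∈ E)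
    (hik' : i ≠ k) (hjk' : j ≠ k) (hij : i ≠ j)
    (h1 : edgeDefect i j g (u * Equiv.swap j k) = 0)
    (h2 : edgeDefect i j g (u * Equiv.swap i j * Equiv.swap j k) = 0) :
    X i - X k ∣ edgeDefect i j g u := by
  set s := Equiv.swap j k with hs
  set r := Equiv.swap i j with hr
  have e : s * r * s = r * s * r := by
    have e1 : s * r = Equiv.swap i k * s := by
      rw [hr, Equiv.mul_swap_eq_swap_mul, hs, Equiv.swap_apply_left,
        Equiv.swap_apply_of_ne_of_ne hij hik']
    have e2 : r * s = Equiv.swap i k * r := by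
      rw [hs, Equiv.mul_swap_eq_swap_mul, hr, Equiv.swap_apply_right,
        Equiv.swap_apply_of_ne_of_ne hik'.symm hjk'.symm]
    rw [e1, e2, mul_assoc, mul_assoc, hs, hr, Equiv.swap_mul_self, Equiv.swap_mul_self]
  have a1 := hg j k hjk u
  have a2 := hg j k hjk (u * r)
  have a3 := hg j k hjk (u * s * r)
  rw [← hs] at a1 a2 a3
  have e' : u * s * r * s = u * r * s * r := by
    rw [mul_assoc u s r, mul_assoc u _ s, e, ← mul_assoc, ← mul_assoc]
  rw [e'] at a3
  have h := map_dvd (collapse K i j) (dvd_add (dvd_sub a1 a2) a3)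
  have h' : g u - g (u * s) - (g (u * r) - g (u * r * s)) +
      (g (u * s * r) - g (u * r * s * r)) = g u - g (u * r) - (g (u * s) - g (u * s * r)) +
        (g (u * r * s) - g (u * r * s * r)) := by ring
  rw [h', map_add, map_sub (collapse K i j) (_ - _)] at h
  change _ ∣ edgeDefect i j g u - edgeDefect i j g (u * s) + edgeDefect i j g (u * r * s) at h
  rwa [h1, h2, sub_zero, add_zero, map_sub, collapse_X_self, collapse_X_of_ne hjk'.symm] at h

/-- The pair `(c, d)`, with `c < d`, such that the factor `X a - X b` of a leading term becomes
`± (X c - X d)` under the substitution `X j ↦ X i`. -/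
def collapsedPair (i j : Fin n) (p : Fin n × Fin n) : Fin n × Fin n :=
  if p.2 = j then (i, p.1) else (Function.update id j i p.1, p.2)

/-- The data for the removal of one edge: a closed set of pairs `E` with a pair `(i, j) ∈ E` such
that `i` is as small as possible, and then `j` as large as possible. -/
structure IsExtremalEdge (E : Finset (Fin n × Fin n)) (i j : Fin n) : Prop where
  closed : IsIntervalClosed E
  mem : (i, j) ∈ E
  le_left : ∀ a b, (a, b) ∈ E → i ≤ a
  right_le : ∀ b, (i, b) ∈ E → b ≤ j

namespace IsExtremalEdge

lemma lt (h : IsExtremalEdge E i j) : i < j := h.closed.1 i j h.mem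

lemma erase_closed (h : IsExtremalEdge E i j) : IsIntervalClosed (E.erase (i, j)) := by
  refine ⟨fun a b hab => h.closed.1 a b (Finset.mem_of_mem_erase hab), ?_⟩
  intro a b hab c d hac hcd hdb
  obtain ⟨hne, hab'⟩ := Finset.mem_erase.1 hab
  refine Finset.mem_erase.2 ⟨fun hcd' => hne ?_, h.closed.2 a b hab' c d hac hcd hdb⟩
  obtain ⟨rfl, rfl⟩ := Prod.mk.inj hcd'
  obtain rfl := le_antisymm hac (h.le_left a b hab')
  rw [le_antisymm (h.right_le b hab') hdb]

lemma between (h : IsExtremalEdge E i j) (hik : i < k) (hkj : k < j) :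
    (i, k) ∈ E.erase (i, j) ∧ (k, j) ∈ E.erase (i, j) := by
  refine ⟨Finset.mem_erase.2 ⟨fun he => ?_, ?_⟩, Finset.mem_erase.2 ⟨fun he => ?_, ?_⟩⟩
  · exact hkj.ne (Prod.mk.inj he).2
  · exact h.closed.2 i j h.mem _ _ le_rfl hik hkj.le
  · exact hik.ne' (Prod.mk.inj he).1
  · exact h.closed.2 i j h.mem _ _ hik.le hkj le_rfl

/-- The four kinds of edges other than `(i, j)`. -/
lemma edge_cases (h : IsExtremalEdge E i j) {a b : Fin n} (hab : (a, b) ∈ E.erase (i, j)) :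
    (a = i ∧ i < b ∧ b < j) ∨ (b = j ∧ i < a ∧ a < j) ∨ (a = j ∧ j < b) ∨
      (a ≠ i ∧ a ≠ j ∧ b ≠ i ∧ b ≠ j ∧ i < a ∧ a < b) := by
  obtain ⟨hne, hab'⟩ := Finset.mem_erase.1 hab
  have h1 := h.closed.1 a b hab'
  have h2 := h.le_left a b hab'
  by_cases hai : a = i
  · subst hai
    have h3 := h.right_le b hab'
    have h4 : b ≠ j := fun hb => hne (by rw [hb])
    exact Or.inl ⟨rfl, h1, lt_of_le_of_ne h3 h4⟩
  · have h3 : i < a := lt_of_le_of_ne h2 (Ne.symm hai)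
    by_cases hbj : b = j
    · exact Or.inr (Or.inl ⟨hbj, h3, hbj ▸ h1⟩)
    · by_cases haj : a = j
      · exact Or.inr (Or.inr (Or.inl ⟨haj, haj ▸ h1⟩))
      · exact Or.inr (Or.inr (Or.inr ⟨hai, haj, (h3.trans h1).ne', hbj, h3, h1⟩))

lemma collapsedPair_spec (h : IsExtremalEdge E i j) {p : Fin n × Fin n}
    (hp : p ∈ E.erase (i, j)) :
    (collapsedPair i j p).1 < (collapsedPair i j p).2 ∧
      (collapse K i j (X p.1 - X p.2) = X (collapsedPair i j p).1 - X (collapsedPair i j p).2 ∨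
      collapse K i j (X p.1 - X p.2) = X (collapsedPair i j p).2 - X (collapsedPair i j p).1) := by
  obtain ⟨a, b⟩ := p
  have hij := h.lt
  rcases h.edge_cases hp with ⟨rfl, h1, h2⟩ | ⟨rfl, h1, h2⟩ | ⟨rfl, h1⟩ | ⟨-, h1, -, h3, -, h4⟩
  · simp [collapsedPair, h2.ne, hij.ne, h1, collapse_X_of_ne]
  · simp [collapsedPair, h1, h2.ne, collapse_X_of_ne, collapse_X_self]
  · simp [collapsedPair, h1.ne', collapse_X_of_ne, collapse_X_self, hij.trans h1]
  · simp [collapsedPair, h1, h3, h4, collapse_X_of_ne]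

lemma isRelPrime_collapse (h : IsExtremalEdge E i j) {p q : Fin n × Fin n}
    (hp : p ∈ E.erase (i, j)) (hq : q ∈ E.erase (i, j))
    (hpq : collapsedPair i j p ≠ collapsedPair i j q) :
    IsRelPrime (collapse K i j (X p.1 - X p.2)) (collapse K i j (X q.1 - X q.2)) := by
  obtain ⟨hp1, hp2⟩ := h.collapsedPair_spec (K := K) hp
  obtain ⟨hq1, hq2⟩ := h.collapsedPair_spec (K := K) hq
  have h1 : ¬((collapsedPair i j p).1 = (collapsedPair i j q).1 ∧
      (collapsedPair i j p).2 = (collapsedPair i j q).2) := fun h => hpq (Prod.ext h.1 h.2)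
  have h2 : ¬((collapsedPair i j p).1 = (collapsedPair i j q).2 ∧
      (collapsedPair i j p).2 = (collapsedPair i j q).1) := by
    rintro ⟨h3, h4⟩
    rw [h3, h4] at hp1
    exact hp1.asymm hq1
  rcases hp2 with hp2 | hp2 <;> rcases hq2 with hq2 | hq2 <;> rw [hp2, hq2]
  · exact isRelPrime_X_sub_X hp1.ne hq1.ne h1 h2
  · exact isRelPrime_X_sub_X hp1.ne hq1.ne' h2 h1
  · exact isRelPrime_X_sub_X hp1.ne' hq1.ne (fun h => h2 h.symm) fun h => h1 h.symm
  · exact isRelPrime_X_sub_X hp1.ne' hq1.ne' (fun h => h1 h.symm) fun h => h2 h.symm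

/-- The leading terms modulo `X i - X j` divide the edge defects of splines on the smaller graph.
The factors at pairs `(i, k)` and `(k, j)` agree up to sign, so that the square of a prime has to
be considered if both of them are inversions. -/
lemma collapse_leadingTerm_dvd (h : IsExtremalEdge E i j)
    (hg : g ∈ splines K (E.erase (i, j))) (hu : u j < u i)
    (hq : ∀ w < u, w j < w i → edgeDefect i j g w = 0) :
    collapse K i j (leadingTerm K (E.erase (i, j)) u) ∣ edgeDefect i j g u := by
  have hij := h.lt
  set s := inversions (E.erase (i, j)) u with hs
  have hsE : ∀ p ∈ s, p ∈ E.erase (i, j) := fun p hp => (mem_inversions.1 hp).1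
  rw [leadingTerm, map_prod, ← Finset.prod_fiberwise_of_maps_to
    (t := s.image (collapsedPair i j)) (g := collapsedPair i j)
    (fun p hp => Finset.mem_image_of_mem _ hp)]
  refine Finset.prod_dvd_of_isRelPrime ?_ ?_
  · intro c _ d _ hcd
    refine IsRelPrime.prod_left fun p hp => IsRelPrime.prod_right fun q hq => ?_
    obtain ⟨hp', rfl⟩ := Finset.mem_filter.1 hp
    obtain ⟨hq', rfl⟩ := Finset.mem_filter.1 hq
    exact h.isRelPrime_collapse (hsE p hp') (hsE q hq') hcd
  · intro c hc
    obtain ⟨p, hp, rfl⟩ := Finset.mem_image.1 hc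
    -- It suffices to find a larger set of pairs over which the product divides.
    have reduce : ∀ t : Finset (Fin n × Fin n),
        (∀ q ∈ s, collapsedPair i j q = collapsedPair i j p → q ∈ t) →
        (∏ q ∈ t, collapse K i j (X q.1 - X q.2)) ∣ edgeDefect i j g u →
        (∏ q ∈ s with collapsedPair i j q = collapsedPair i j p,
          collapse K i j (X q.1 - X q.2)) ∣ edgeDefect i j g u := fun t ht htd =>
      (Finset.prod_dvd_prod_of_subset _ t _ fun q hq =>
        ht q (Finset.mem_filter.1 hq).1 (Finset.mem_filter.1 hq).2).trans htd
    have hpE := hsE p hp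
    have hpu := (mem_inversions.1 hp).2
    have between : ∀ k, i < k → k < j → collapsedPair i j p = (i, k) →
        (∏ q ∈ s with collapsedPair i j q = collapsedPair i j p,
          collapse K i j (X q.1 - X q.2)) ∣ edgeDefect i j g u := by
      intro k hik hkj hpk
      obtain ⟨hikE, hkjE⟩ := h.between hik hkj
      have hfib : ∀ q ∈ s, collapsedPair i j q = collapsedPair i j p →
          q = (i, k) ∨ q = (k, j) := by
        rintro ⟨a, b⟩ hq hqp
        rw [hpk] at hqp
        rcases h.edge_cases (hsE _ hq) with ⟨rfl, h1, h2⟩ | ⟨rfl, h1, h2⟩ | ⟨rfl, h1⟩ |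
          ⟨h0, h1, -, h3, -, h4⟩
        · simp [collapsedPair, h2.ne, hij.ne] at hqp
          simp [hqp]
        · simp [collapsedPair] at hqp
          simp [hqp]
        · simp [collapsedPair, h1.ne'] at hqp
          exact absurd (hqp ▸ h1) hkj.asymm
        · simp [collapsedPair, h1, h3] at hqp
          exact absurd hqp.1 h0
      have hdvd : X i - X k ∣ edgeDefect i j g u :=
        dvd_edgeDefect_of_between hg hikE hkjE hkj.ne hij.ne
      by_cases h1 : (i, k) ∈ s
      · by_cases h2 : (k, j) ∈ s
        · refine reduce {(i, k), (k, j)} (fun q hq hqp => by simpa using hfib q hq hqp) ?_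
          rw [Finset.prod_pair (fun he => hik.ne (Prod.mk.inj he).1), ← map_mul]
          have h1' := (mem_inversions.1 h1).2
          have h2' := (mem_inversions.1 h2).2
          refine mul_dvd_edgeDefect_of_between hg hikE hkjE hik.ne hkj.ne hij.ne
            (hq _ (mul_swap_lt hik h1') ?_) (hq _ (mul_swap_lt hkj h2') ?_)
          · rw [Equiv.Perm.mul_apply, Equiv.Perm.mul_apply, Equiv.swap_apply_left,
              Equiv.swap_apply_of_ne_of_ne hij.ne' hkj.ne']
            exact h2'
          · rw [Equiv.Perm.mul_apply, Equiv.Perm.mul_apply, Equiv.swap_apply_right,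
              Equiv.swap_apply_of_ne_of_ne hik.ne hij.ne]
            exact h1'
        · refine reduce {(i, k)} (fun q hq hqp => ?_) ?_
          · rcases hfib q hq hqp with rfl | rfl
            · exact Finset.mem_singleton_self _
            · exact absurd hq h2
          · rwa [Finset.prod_singleton, map_sub, collapse_X_of_ne hij.ne, collapse_X_of_ne hkj.ne]
      · refine reduce {(k, j)} (fun q hq hqp => ?_) ?_
        · rcases hfib q hq hqp with rfl | rfl
          · exact absurd hq h1
          · exact Finset.mem_singleton_self _
        · rwa [Finset.prod_singleton, map_sub, collapse_X_self, collapse_X_of_ne hkj.ne, ← neg_sub,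
            neg_dvd]
    obtain ⟨a, b⟩ := p
    rcases h.edge_cases hpE with ⟨rfl, h1, h2⟩ | ⟨rfl, h1, h2⟩ | ⟨rfl, h1⟩ |
      ⟨h0, h1, h2, h3, h4, h5⟩
    · exact between b h1 h2 (by simp [collapsedPair, h2.ne, hij.ne])
    · exact between a h1 h2 (by simp [collapsedPair])
    · refine reduce {(a, b)} ?_ ?_
      · rintro ⟨c, d⟩ hq hqp
        rcases h.edge_cases (hsE _ hq) with ⟨rfl, h1', h2⟩ | ⟨rfl, h1', h2⟩ | ⟨rfl, h1'⟩ |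
          ⟨h0, h1', -, h3, -, h4⟩
        · simp [collapsedPair, h2.ne, hij.ne, h1.ne'] at hqp
          exact absurd (hqp ▸ h1) h2.asymm
        · simp [collapsedPair, h1.ne'] at hqp
          exact absurd (hqp ▸ h1) h2.asymm
        · simp [collapsedPair, h1.ne', h1'.ne'] at hqp
          simp [hqp]
        · simp [collapsedPair, h1.ne', h1', h3] at hqp
          exact absurd hqp.1 h0
      · rw [Finset.prod_singleton, map_sub, collapse_X_self, collapse_X_of_ne h1.ne']
        have hlt := mul_swap_lt h1 hpu
        have hlt2 : u * Equiv.swap i a * Equiv.swap a b < u := by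
          refine (mul_swap_lt h1 ?_).trans (mul_swap_lt hij hu)
          rw [Equiv.Perm.mul_apply, Equiv.Perm.mul_apply, Equiv.swap_apply_right,
            Equiv.swap_apply_of_ne_of_ne (hij.trans h1).ne' h1.ne']
          exact hpu.trans hu
        refine dvd_edgeDefect_of_right hg hpE (hij.trans h1).ne h1.ne hij.ne
          (hq _ hlt ?_) (hq _ hlt2 ?_)
        · rw [Equiv.Perm.mul_apply, Equiv.Perm.mul_apply, Equiv.swap_apply_left,
            Equiv.swap_apply_of_ne_of_ne hij.ne (hij.trans h1).ne]
          exact hpu.trans hu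
        · rw [Equiv.Perm.mul_apply, Equiv.Perm.mul_apply, Equiv.Perm.mul_apply,
            Equiv.Perm.mul_apply, Equiv.swap_apply_left,
            Equiv.swap_apply_of_ne_of_ne (hij.trans h1).ne' h1.ne',
            Equiv.swap_apply_of_ne_of_ne hij.ne (hij.trans h1).ne, Equiv.swap_apply_left]
          exact hpu
    · refine reduce {(a, b)} ?_ ?_
      · rintro ⟨c, d⟩ hq hqp
        rcases h.edge_cases (hsE _ hq) with ⟨rfl, h1', h2'⟩ | ⟨rfl, h1', h2'⟩ | ⟨rfl, h1'⟩ |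
          ⟨h0', h1', -, h3', -, h4'⟩
        · simp [collapsedPair, h2'.ne, hij.ne, h1, h3] at hqp
          exact absurd hqp.1.symm h0
        · simp [collapsedPair, h1, h3] at hqp
          exact absurd hqp.1.symm h0
        · simp [collapsedPair, h1'.ne', h1, h3] at hqp
          exact absurd hqp.1.symm h0
        · simp [collapsedPair, h1, h3, h1', h3'] at hqp
          simp [hqp]
      · rw [Finset.prod_singleton, map_sub, collapse_X_of_ne h1, collapse_X_of_ne h3]
        refine dvd_edgeDefect_of_disjoint hg hpE h0 h1 h2 h3 (hq _ (mul_swap_lt h5 hpu) ?_)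
        rw [Equiv.Perm.mul_apply, Equiv.Perm.mul_apply,
          Equiv.swap_apply_of_ne_of_ne h0.symm h2.symm,
          Equiv.swap_apply_of_ne_of_ne h1.symm h3.symm]
        exact hu

end IsExtremalEdge

/-! ### Flow-up splines -/

/-- A spline which vanishes at all `u < v` and has the leading term of `v` as its value at `v`. -/
structure IsFlowUp (E : Finset (Fin n × Fin n)) (v : Equiv.Perm (Fin n))
    (p : Equiv.Perm (Fin n) → MvPolynomial (Fin n) K) : Prop where
  mem : p ∈ splines K E
  eq_zero : ∀ u < v, p u = 0
  apply_self : p v = leadingTerm K E v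

namespace IsExtremalEdge

lemma mem_splines_of_edgeDefect (h : IsExtremalEdge E i j) (hg : g ∈ splines K (E.erase (i, j)))
    (hq : ∀ w, w j < w i → edgeDefect i j g w = 0) : g ∈ splines K E := by
  intro a b hab β
  by_cases he : (a, b) = (i, j)
  · obtain ⟨rfl, rfl⟩ := Prod.mk.inj he
    rw [X_sub_X_dvd_iff]
    change edgeDefect a b g β = 0
    rcases lt_or_ge (β b) (β a) with hlt | hge
    · exact hq β hlt
    · rw [← neg_eq_zero, ← edgeDefect_mul_swap]
      refine hq _ ?_
      rw [Equiv.Perm.mul_apply, Equiv.Perm.mul_apply, Equiv.swap_apply_left,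
        Equiv.swap_apply_right]
      exact lt_of_le_of_ne hge fun he => h.lt.ne (β.injective he)
  · exact hg a b (Finset.mem_erase.2 ⟨he, hab⟩) β

/-- The edge defects of `g` can be removed, one after the other in lexicographic order, by the
subtraction of multiples of flow-up splines. -/
lemma exists_spline_of_flowUp (h : IsExtremalEdge E i j)
    {p : Equiv.Perm (Fin n) → Equiv.Perm (Fin n) → MvPolynomial (Fin n) K}
    (hp : ∀ v, IsFlowUp (E.erase (i, j)) v (p v)) {v : Equiv.Perm (Fin n)} (hv : v i < v j)
    (hg : g ∈ splines K (E.erase (i, j))) (hgv : ∀ w < v, g w = 0) :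
    ∃ g' ∈ splines K E, (∀ w < v, g' w = 0) ∧ g' v = g v := by
  have hij := h.lt
  -- The induction is on the first permutation with a nonzero edge defect, from above.
  have step : ∀ u : Equiv.Perm (Fin n), ∀ g ∈ splines K (E.erase (i, j)), (∀ w < v, g w = 0) →
      u j < u i → (∀ w < u, w j < w i → edgeDefect i j g w = 0) →
      ∃ g' ∈ splines K E, (∀ w < v, g' w = 0) ∧ g' v = g v := by
    intro u
    induction u using WellFoundedGT.induction with
    | ind u ih =>
    intro g hg hgv hu hq
    obtain ⟨g₁, hg₁, hg₁v, hg₁v', hq₁⟩ : ∃ g₁ ∈ splines K (E.erase (i, j)), (∀ w < v, g₁ w = 0) ∧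
        g₁ v = g v ∧ ∀ w ≤ u, w j < w i → edgeDefect i j g₁ w = 0 := by
      have hsw : u * Equiv.swap i j < u := mul_swap_lt hij hu
      rcases lt_or_ge u v with huv | hvu
      · refine ⟨g, hg, hgv, rfl, fun w hw hwi => ?_⟩
        rcases hw.lt_or_eq with hw | rfl
        · exact hq w hw hwi
        · rw [edgeDefect, hgv _ huv, hgv _ (hsw.trans huv), sub_zero, map_zero]
      · have hne : v ≠ u := by rintro rfl; exact hv.asymm hu
        have hlt : v < u := lt_of_le_of_ne hvu hne
        obtain ⟨c, hc⟩ := h.collapse_leadingTerm_dvd hg hu hq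
        have hdef : ∀ w, edgeDefect i j (g - c • p u) w =
            edgeDefect i j g w - collapse K i j c * edgeDefect i j (p u) w := by
          intro w
          rw [edgeDefect, edgeDefect, edgeDefect, ← map_mul, ← map_sub]
          congr 1
          simp only [Pi.sub_apply, Pi.smul_apply, smul_eq_mul]
          ring
        refine ⟨g - c • p u, Submodule.sub_mem _ hg (Submodule.smul_mem _ c (hp u).mem),
          fun w hw => ?_, ?_, fun w hw hwi => ?_⟩
        · rw [Pi.sub_apply, Pi.smul_apply, hgv w hw, (hp u).eq_zero w (hw.trans hlt), smul_zero,
            sub_zero]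
        · rw [Pi.sub_apply, Pi.smul_apply, (hp u).eq_zero v hlt, smul_zero, sub_zero]
        · rw [hdef]
          rcases hw.lt_or_eq with hw | rfl
          · have h0 : edgeDefect i j (p u) w = 0 := by
              rw [edgeDefect, (hp u).eq_zero w hw,
                (hp u).eq_zero _ ((mul_swap_lt hij hwi).trans hw), sub_zero, map_zero]
            rw [hq w hw hwi, h0, mul_zero, sub_zero]
          · have h0 : edgeDefect i j (p w) w =
                collapse K i j (leadingTerm K (E.erase (i, j)) w) := by
              rw [edgeDefect, (hp w).eq_zero _ hsw, sub_zero, (hp w).apply_self]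
            -- Reduction modulo `X i - X j` on both sides replaces the quotient `c` by its image.
            have h1 := congrArg (collapse K i j) hc
            rw [edgeDefect, collapse_idem, map_mul, collapse_idem, ← edgeDefect] at h1
            rw [h0, h1, mul_comm, sub_self]
    by_cases hall : ∀ w, w j < w i → edgeDefect i j g₁ w = 0
    · exact ⟨g₁, h.mem_splines_of_edgeDefect hg₁ hall, hg₁v, hg₁v'⟩
    · push Not at hall
      obtain ⟨w, ⟨hwi, hw⟩, hmin⟩ := wellFounded_lt.has_min
        {w : Equiv.Perm (Fin n) | w j < w i ∧ edgeDefect i j g₁ w ≠ 0} hall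
      have huw : u < w := lt_of_not_ge fun hle => hw (hq₁ w hle hwi)
      rw [← hg₁v']
      exact ih w huw g₁ hg₁ hg₁v hwi fun w' hw' hwi' => by
        by_contra hne
        exact hmin w' ⟨hwi', hne⟩ hw'
  by_cases hall : ∀ w, w j < w i → edgeDefect i j g w = 0
  · exact ⟨g, h.mem_splines_of_edgeDefect hg hall, hgv, rfl⟩
  · push Not at hall
    obtain ⟨w, ⟨hwi, hw⟩, hmin⟩ := wellFounded_lt.has_min
      {w : Equiv.Perm (Fin n) | w j < w i ∧ edgeDefect i j g w ≠ 0} hall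
    exact step w g hg hgv hwi fun w' hw' hwi' => by
      by_contra hne
      exact hmin w' ⟨hwi', hne⟩ hw'

/-- Adding the pair `(i, j)` multiplies the leading term at `v` by `X i - X j` if the pair is an
inversion of `v`, and does not change it otherwise. -/
lemma exists_isFlowUp (h : IsExtremalEdge E i j)
    (hp : ∀ v, ∃ p : Equiv.Perm (Fin n) → MvPolynomial (Fin n) K, IsFlowUp (E.erase (i, j)) v p)
    (v : Equiv.Perm (Fin n)) :
    ∃ p : Equiv.Perm (Fin n) → MvPolynomial (Fin n) K, IsFlowUp E v p := by
  choose p hp using hp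
  rcases lt_or_ge (v j) (v i) with hv | hv
  · have hinv : inversions E v = insert (i, j) (inversions (E.erase (i, j)) v) := by
      rw [inversions, inversions, Finset.filter_erase, Finset.insert_erase]
      exact Finset.mem_filter.2 ⟨h.mem, hv⟩
    have hnot : (i, j) ∉ inversions (E.erase (i, j)) v := fun hm =>
      Finset.notMem_erase _ _ (mem_inversions.1 hm).1
    refine ⟨(X i - X j : MvPolynomial (Fin n) K) • p v, fun a b hab β => ?_, fun u hu => ?_, ?_⟩
    · by_cases he : (a, b) = (i, j)
      · obtain ⟨rfl, rfl⟩ := Prod.mk.inj he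
        rw [Pi.smul_apply, Pi.smul_apply, ← smul_sub, smul_eq_mul]
        exact dvd_mul_right _ _
      · exact Submodule.smul_mem _ _ (hp v).mem a b (Finset.mem_erase.2 ⟨he, hab⟩) β
    · rw [Pi.smul_apply, (hp v).eq_zero u hu, smul_zero]
    · rw [Pi.smul_apply, (hp v).apply_self, leadingTerm, leadingTerm, hinv,
        Finset.prod_insert hnot, smul_eq_mul]
  · have hlt : v i < v j := lt_of_le_of_ne hv fun he => h.lt.ne (v.injective he)
    have hinv : inversions E v = inversions (E.erase (i, j)) v := by
      rw [inversions, inversions, Finset.filter_erase, Finset.erase_eq_of_notMem]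
      exact fun hm => (Finset.mem_filter.1 hm).2.asymm hlt
    obtain ⟨q, hq, hq0, hqv⟩ := h.exists_spline_of_flowUp hp hlt (hp v).mem (hp v).eq_zero
    exact ⟨q, hq, hq0, by rw [hqv, (hp v).apply_self, leadingTerm, leadingTerm, hinv]⟩

end IsExtremalEdge

lemma exists_isExtremalEdge (hE : IsIntervalClosed E) (hne : E.Nonempty) :
    ∃ i j, IsExtremalEdge E i j := by
  obtain ⟨⟨i, b⟩, hib, hi⟩ := E.exists_min_image Prod.fst hne
  obtain ⟨⟨i', j⟩, hij, hj⟩ := (E.filter fun p => p.1 = i).exists_max_image Prod.snd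
    ⟨(i, b), Finset.mem_filter.2 ⟨hib, rfl⟩⟩
  obtain ⟨hij', hi'⟩ := Finset.mem_filter.1 hij
  obtain rfl : i' = i := hi'
  exact ⟨i', j, hE, hij', fun a b hab => hi (a, b) hab,
    fun b hb => hj (i', b) (Finset.mem_filter.2 ⟨hb, rfl⟩)⟩

/-- Flow-up splines exist for every interval-closed set of pairs, by induction on the number of
pairs; without edges they are the indicator functions. -/
theorem exists_isFlowUp (hE : IsIntervalClosed E) (v : Equiv.Perm (Fin n)) :
    ∃ p : Equiv.Perm (Fin n) → MvPolynomial (Fin n) K, IsFlowUp E v p := by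
  induction E using Finset.strongInduction generalizing v with
  | H E ih =>
  rcases E.eq_empty_or_nonempty with rfl | hne
  · refine ⟨Pi.single v 1, fun a b hab => absurd hab (Finset.notMem_empty _), fun u hu => ?_, ?_⟩
    · exact Pi.single_eq_of_ne hu.ne _
    · rw [Pi.single_eq_same]; rfl
  · obtain ⟨i, j, h⟩ := exists_isExtremalEdge hE hne
    exact h.exists_isFlowUp (ih _ (Finset.erase_ssubset h.mem) h.erase_closed) v

/-- Flow-up splines can be chosen to be homogeneous. -/
theorem exists_isFlowUp_isHomogeneous (hE : IsIntervalClosed E) (v : Equiv.Perm (Fin n)) :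
    ∃ p : Equiv.Perm (Fin n) → MvPolynomial (Fin n) K, IsFlowUp E v p ∧
      ∀ u, (p u).IsHomogeneous (inversions E v).card := by
  obtain ⟨p, hp⟩ := exists_isFlowUp (K := K) hE v
  refine ⟨fun u => homogeneousComponent (inversions E v).card (p u), ⟨fun a b hab β => ?_,
    fun u hu => ?_, ?_⟩, fun u => homogeneousComponent_isHomogeneous _ _⟩
  · rw [← map_sub]
    exact X_sub_X_dvd_homogeneousComponent (hp.mem a b hab β) _
  · rw [hp.eq_zero u hu, map_zero]
  · rw [hp.apply_self, homogeneousComponent_of_mem (leadingTerm_isHomogeneous E v), if_pos rfl]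

end Spline

/-! ### Bases from triangular families -/

section Triangular

variable {I A M S : Type*} [Fintype I] [LinearOrder I] [CommRing A] [AddCommGroup M] [Module A M]
  [CommRing S] (ev : I → M →+ S) (σ : I → A →+* S) (p : I → M)

/-- A family which is triangular with respect to semilinear evaluation maps, with nonzero
diagonal entries, is linearly independent. -/
lemma linearIndependent_of_triangular [IsDomain S] (hσ : ∀ v, Function.Injective (σ v))
    (hsmul : ∀ v a x, ev v (a • x) = σ v a * ev v x) (hlt : ∀ u v, u < v → ev u (p v) = 0)
    (hne : ∀ v, ev v (p v) ≠ 0) : LinearIndependent A p := by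
  rw [Fintype.linearIndependent_iff]
  intro a ha v
  induction v using WellFoundedLT.induction with
  | ind v ih =>
  have h := congrArg (ev v) ha
  rw [map_sum, map_zero, Finset.sum_eq_single v, hsmul] at h
  · exact (map_eq_zero_iff _ (hσ v)).1 ((mul_eq_zero.1 h).resolve_right (hne v))
  · intro u _ huv
    rcases huv.lt_or_gt with huv | huv
    · rw [ih u huv, zero_smul, map_zero]
    · rw [hsmul, hlt v u huv, mul_zero]
  · exact fun hv => absurd (Finset.mem_univ v) hv

/-- A family which is triangular with respect to semilinear evaluation maps, and whose diagonal
entries divide all possible first nonzero values, spans. -/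
lemma span_eq_top_of_triangular (hσ : ∀ v, Function.Surjective (σ v))
    (hsmul : ∀ v a x, ev v (a • x) = σ v a * ev v x) (hlt : ∀ u v, u < v → ev u (p v) = 0)
    (hdvd : ∀ v x, (∀ u < v, ev u x = 0) → ev v (p v) ∣ ev v x)
    (hinj : ∀ x, (∀ v, ev v x = 0) → x = 0) : ⊤ ≤ Submodule.span A (Set.range p) := by
  have first : ∀ x, x = 0 ∨ ∃ v, ev v x ≠ 0 ∧ ∀ u < v, ev u x = 0 := by
    intro x
    by_cases hx : ∀ v, ev v x = 0
    · exact Or.inl (hinj x hx)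
    · push Not at hx
      obtain ⟨v, hv, hmin⟩ := wellFounded_lt.has_min {v : I | ev v x ≠ 0} hx
      exact Or.inr ⟨v, hv, fun u hu => by_contra fun h => hmin u h hu⟩
  have step : ∀ v x, (∀ u < v, ev u x = 0) → x ∈ Submodule.span A (Set.range p) := by
    intro v
    induction v using WellFoundedGT.induction with
    | ind v ih =>
    intro x hx
    obtain ⟨c, hc⟩ := hdvd v x hx
    obtain ⟨a, rfl⟩ := hσ v c
    have hp : a • p v ∈ Submodule.span A (Set.range p) :=
      Submodule.smul_mem _ _ (Submodule.subset_span ⟨v, rfl⟩)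
    have hx' : ∀ u ≤ v, ev u (x - a • p v) = 0 := by
      intro u hu
      rw [map_sub, hsmul]
      rcases hu.lt_or_eq with hu | rfl
      · rw [hx u hu, hlt u v hu, mul_zero, sub_zero]
      · rw [hc, mul_comm, sub_self]
    rw [← sub_add_cancel x (a • p v)]
    refine Submodule.add_mem _ ?_ hp
    rcases first (x - a • p v) with h0 | ⟨w, hw, hwlt⟩
    · rw [h0]; exact Submodule.zero_mem _
    · exact ih w (lt_of_not_ge fun hle => hw (hx' w hle)) _ hwlt
  rintro x -
  rcases first x with rfl | ⟨v, -, hv⟩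
  · exact Submodule.zero_mem _
  · exact step v x hv

end Triangular

/-! ### Gradings as eigenspaces and graded traces -/

/-- The part of degree `d` is the `2 ^ d`-eigenspace of `s`. For polynomials, `s` is the
substitution `X k ↦ 2 X k`; any number whose powers are distinct would do in place of `2`. -/
def IsScaling {M : Type*} [AddCommGroup M] [Module ℂ M] (𝓜 : ℕ → Submodule ℂ M) (s : M → M) :
    Prop :=
  ∀ d x, x ∈ 𝓜 d ↔ s x = (2 : ℂ) ^ d • x

section Trace

variable {A M : Type} [CommRing A] [AddCommGroup M] [Module ℂ M] [Module A M]
  {𝓜 : ℕ → Submodule ℂ M}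

lemma HomogeneousBasis.mem_of_deg_eq (e : HomogeneousBasis A 𝓜) {i : e.ι} {d : ℕ}
    (h : e.deg i = d) : e.basis i ∈ 𝓜 d :=
  h ▸ e.homogeneous i

variable [Algebra ℂ A] {𝓐 : ℕ → Submodule ℂ A} {sA : A →ₐ[ℂ] A} {sM : M →ₗ[ℂ] M}

namespace HomogeneousBasis

lemma coeff_trace (e : HomogeneousBasis A 𝓜) (φ : M →ₗ[ℂ] M) (d : ℕ)
    (hfin : {i | e.deg i = d}.Finite) : PowerSeries.coeff d (e.trace φ) =
      ∑ i ∈ hfin.toFinset, Function.invFun (algebraMap ℂ A) (e.diagCoeff φ i) := by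
  rw [trace, PowerSeries.coeff_mk, finsum_mem_eq_finite_toFinset_sum _ hfin]

variable [IsScalarTower ℂ A M]

/-- The coefficients of an element of degree `d` with respect to a homogeneous basis `e` are
homogeneous of degree `d - deg e_i`. -/
lemma scale_repr (hM : IsScaling 𝓜 sM) (hsmul : ∀ (a : A) x, sM (a • x) = sA a • sM x)
    (e : HomogeneousBasis A 𝓜) {d : ℕ} {x : M} (hx : x ∈ 𝓜 d) (i : e.ι) :
    (2 : ℂ) ^ e.deg i • sA (e.basis.repr x i) = (2 : ℂ) ^ d • e.basis.repr x i := by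
  have key : ∀ y : M, e.basis.repr (sM y) i = (2 : ℂ) ^ e.deg i • sA (e.basis.repr y i) := by
    intro y
    induction e.basis.mem_span y using Submodule.span_induction with
    | mem y hy =>
      obtain ⟨k, rfl⟩ := hy
      rw [(hM _ _).1 (e.homogeneous k), ← algebraMap_smul A, map_smul, Finsupp.smul_apply,
        e.basis.repr_self, algebraMap_smul]
      by_cases hk : k = i
      · subst hk; rw [Finsupp.single_eq_same, map_one]
      · rw [Finsupp.single_eq_of_ne' hk, map_zero, smul_zero, smul_zero]
    | zero => simp
    | add y z _ _ hy hz => simp only [map_add, Finsupp.add_apply, hy, hz, smul_add]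
    | smul a y _ hy =>
      rw [hsmul, map_smul, map_smul, Finsupp.smul_apply, Finsupp.smul_apply, hy, smul_eq_mul,
        smul_eq_mul, map_mul, mul_smul_comm]
  rw [← key, (hM _ _).1 hx, ← algebraMap_smul A, map_smul, Finsupp.smul_apply, algebraMap_smul]

lemma finite_deg [Nontrivial A] (hfin : ∀ d, FiniteDimensional ℂ (𝓜 d))
    (e : HomogeneousBasis A 𝓜) (d : ℕ) : {i | e.deg i = d}.Finite := by
  have hli : LinearIndependent ℂ e.basis :=
    e.basis.linearIndependent.restrict_scalars fun a b hab =>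
      (algebraMap ℂ A).injective (by simpa [Algebra.algebraMap_eq_smul_one] using hab)
  have hli' : LinearIndependent ℂ fun i : {i | e.deg i = d} =>
      (⟨e.basis i, e.mem_of_deg_eq i.2⟩ : 𝓜 d) :=
    LinearIndependent.of_comp (𝓜 d).subtype (hli.comp _ Subtype.val_injective)
  have := hfin d
  exact Set.finite_coe_iff.1 hli'.finite

lemma exists_algebraMap_eq_diagCoeff (hM : IsScaling 𝓜 sM)
    (hsmul : ∀ (a : A) x, sM (a • x) = sA a • sM x)
    (hA : ∀ a : A, sA a = a → ∃ c : ℂ, algebraMap ℂ A c = a) {φ : M →ₗ[ℂ] M}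
    (hφ : ∀ d, ∀ x ∈ 𝓜 d, φ x ∈ 𝓜 d) (e : HomogeneousBasis A 𝓜) (i : e.ι) :
    ∃ c : ℂ, algebraMap ℂ A c = e.diagCoeff φ i :=
  hA _ <| smul_right_injective _ (pow_ne_zero (e.deg i) (two_ne_zero (α := ℂ)))
    (e.scale_repr hM hsmul (hφ _ _ (e.homogeneous i)) i)

end HomogeneousBasis

lemma invFun_algebraMap [Nontrivial A] {a : A} {c : ℂ} (h : algebraMap ℂ A c = a) :
    Function.invFun (algebraMap ℂ A) a = c := by
  rw [← h]
  exact Function.leftInverse_invFun (algebraMap ℂ A).injective c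

namespace HomogeneousBasis

/-- Over `ℂ`, the coefficient of `q ^ d` in the graded trace is the trace on the part of
degree `d`. -/
lemma coeff_trace_eq_linearMapTrace (hM : IsScaling 𝓜 sM) (hfin : ∀ d, FiniteDimensional ℂ (𝓜 d))
    {φ : M →ₗ[ℂ] M} (hφ : ∀ d, ∀ x ∈ 𝓜 d, φ x ∈ 𝓜 d) (e : HomogeneousBasis ℂ 𝓜) (d : ℕ) :
    PowerSeries.coeff d (e.trace φ) = LinearMap.trace ℂ (𝓜 d) (φ.restrict (hφ d)) := by
  classical
  have hf := e.finite_deg hfin d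
  set v : {i | e.deg i = d} → 𝓜 d := fun i => ⟨e.basis i, e.mem_of_deg_eq i.2⟩ with hv
  have hli : LinearIndependent ℂ v := LinearIndependent.of_comp (𝓜 d).subtype
    (e.basis.linearIndependent.comp _ Subtype.val_injective)
  have hspan : ⊤ ≤ Submodule.span ℂ (Set.range v) := by
    rintro ⟨x, hx⟩ -
    have hzero : ∀ i, e.deg i ≠ d → e.basis.repr x i = 0 := by
      intro i hi
      have h := e.scale_repr (sA := AlgHom.id ℂ ℂ) hM (fun a x => map_smul sM a x) hx i
      rw [AlgHom.id_apply, ← sub_eq_zero, ← sub_smul, smul_eq_zero, sub_eq_zero] at h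
      refine h.resolve_left fun h2 => hi ?_
      exact Nat.pow_right_injective le_rfl (by exact_mod_cast h2)
    have hx' : x ∈ (Submodule.span ℂ (Set.range v)).map (𝓜 d).subtype := by
      rw [← e.basis.linearCombination_repr x, Finsupp.linearCombination_apply]
      refine Submodule.sum_mem _ fun i hi => Submodule.smul_mem _ _ ?_
      have hid : e.deg i = d := by
        by_contra h
        exact Finsupp.mem_support_iff.1 hi (hzero i h)
      exact ⟨v ⟨i, hid⟩, Submodule.subset_span ⟨_, rfl⟩, rfl⟩
    obtain ⟨y, hy, hyx⟩ := hx'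
    rwa [show (⟨x, hx⟩ : 𝓜 d) = y from Subtype.ext hyx.symm]
  set b := Module.Basis.mk hli hspan with hb
  have hbv : ∀ i, b i = v i := fun i => by rw [hb, Module.Basis.mk_apply]
  have hrepr : ∀ (y : 𝓜 d) i, b.repr y i = e.basis.repr y i := by
    intro y i
    have : b.coord i = e.basis.coord i ∘ₗ (𝓜 d).subtype := by
      refine b.ext fun k => ?_
      rw [Module.Basis.coord_apply, b.repr_self, LinearMap.comp_apply, Module.Basis.coord_apply,
        hbv]
      change _ = e.basis.repr (e.basis k) i
      rw [e.basis.repr_self, Finsupp.single_apply, Finsupp.single_apply]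
      simp only [Subtype.ext_iff]
    exact LinearMap.congr_fun this y
  have := hf.fintype
  rw [e.coeff_trace φ d hf, LinearMap.trace_eq_matrix_trace ℂ b, Matrix.trace,
    ← Finset.sum_coe_sort]
  refine Fintype.sum_equiv (Equiv.subtypeEquivRight fun i => hf.mem_toFinset) _ _ fun i => ?_
  rw [Matrix.diag_apply, LinearMap.toMatrix_apply, hrepr, hbv]
  exact invFun_algebraMap rfl

lemma trace_eq_trace (hM : IsScaling 𝓜 sM) (hfin : ∀ d, FiniteDimensional ℂ (𝓜 d))
    {φ : M →ₗ[ℂ] M} (hφ : ∀ d, ∀ x ∈ 𝓜 d, φ x ∈ 𝓜 d) (e e' : HomogeneousBasis ℂ 𝓜) :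
    e.trace φ = e'.trace φ := by
  ext d
  rw [e.coeff_trace_eq_linearMapTrace hM hfin hφ, e'.coeff_trace_eq_linearMapTrace hM hfin hφ]

end HomogeneousBasis

lemma hasGradedTrace_complex (hM : IsScaling 𝓜 sM) (hfin : ∀ d, FiniteDimensional ℂ (𝓜 d))
    {φ : M →ₗ[ℂ] M} (hφ : ∀ d, ∀ x ∈ 𝓜 d, φ x ∈ 𝓜 d) (hne : Nonempty (HomogeneousBasis ℂ 𝓜)) :
    HasGradedTrace ℂ 𝓜 φ where
  exists_basis := hne
  scalar _ _ := ⟨_, rfl⟩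
  finite e d := e.finite_deg hfin d
  unique e e' := e.trace_eq_trace hM hfin hφ e'

lemma HasGradedTrace.gradedTrace_eq {φ : M →ₗ[ℂ] M} (h : HasGradedTrace A 𝓜 φ)
    (e : HomogeneousBasis A 𝓜) : gradedTrace A 𝓜 φ = e.trace φ := by
  rw [gradedTrace, dif_pos h.exists_basis]
  exact h.unique _ _

/-- A homogeneous basis remains one under an automorphism that preserves the grading; conjugate
maps have the same graded trace. -/
lemma gradedTrace_conj (hne : Nonempty (HomogeneousBasis ℂ 𝓜)) {φ ψ : M →ₗ[ℂ] M}
    (hφ : HasGradedTrace ℂ 𝓜 φ) (hψ : HasGradedTrace ℂ 𝓜 ψ) (g : M ≃ₗ[ℂ] M)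
    (hg : ∀ d, ∀ x ∈ 𝓜 d, g x ∈ 𝓜 d) (hconj : ∀ x, ψ (g x) = g (φ x)) :
    gradedTrace ℂ 𝓜 ψ = gradedTrace ℂ 𝓜 φ := by
  obtain ⟨e⟩ := hne
  let e' : HomogeneousBasis ℂ 𝓜 :=
    ⟨e.ι, e.basis.map g, e.deg, fun i => hg _ _ (e.homogeneous i)⟩
  rw [hφ.gradedTrace_eq e, hψ.gradedTrace_eq e']
  have h : ∀ i : e.ι, e'.diagCoeff ψ i = e.diagCoeff φ i := by
    intro i
    change (e.basis.map g).repr (ψ ((e.basis.map g) i)) i = _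
    rw [Module.Basis.map_apply, hconj, Module.Basis.map_repr, LinearEquiv.trans_apply,
      LinearEquiv.symm_apply_apply]
    rfl
  ext d
  rw [HomogeneousBasis.trace, HomogeneousBasis.trace, PowerSeries.coeff_mk, PowerSeries.coeff_mk]
  exact finsum_mem_congr rfl fun i _ => by rw [h i]

variable [IsScalarTower ℂ A M]

/-- The products of the elements of a homogeneous basis of `A` over `ℂ` with those of a homogeneous
basis of `M` over `A`. -/
noncomputable def HomogeneousBasis.prod (hA : IsScaling 𝓐 sA) (hM : IsScaling 𝓜 sM)
    (hsmul : ∀ (a : A) x, sM (a • x) = sA a • sM x)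
    (f : HomogeneousBasis ℂ 𝓐) (e : HomogeneousBasis A 𝓜) : HomogeneousBasis ℂ 𝓜 where
  ι := f.ι × e.ι
  basis := f.basis.smulTower e.basis
  deg i := f.deg i.1 + e.deg i.2
  homogeneous i := by
    rw [hM, Module.Basis.smulTower_apply, hsmul, (hA _ _).1 (f.homogeneous i.1),
      (hM _ _).1 (e.homogeneous i.2), smul_assoc, smul_comm (f.basis i.1), smul_smul, pow_add]

/-- Graded traces are multiplicative in the tower `ℂ ⊆ A ⊆ M`. -/
lemma HomogeneousBasis.trace_prod (hA : IsScaling 𝓐 sA) (hM : IsScaling 𝓜 sM)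
    (hsmul : ∀ (a : A) x, sM (a • x) = sA a • sM x) [Nontrivial A]
    (hfinA : ∀ d, FiniteDimensional ℂ (𝓐 d)) (hfinM : ∀ d, FiniteDimensional ℂ (𝓜 d))
    (f : HomogeneousBasis ℂ 𝓐) (e : HomogeneousBasis A 𝓜) {φ : M →ₗ[ℂ] M} {ψ : A →ₗ[ℂ] A}
    (hφψ : ∀ a x, φ (a • x) = ψ a • φ x)
    (hscalar : ∀ i, ∃ c : ℂ, algebraMap ℂ A c = e.diagCoeff φ i) :
    (f.prod hA hM hsmul e).trace φ = e.trace φ * f.trace ψ := by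
  classical
  choose c hc using hscalar
  have hdiag : ∀ k i, (f.prod hA hM hsmul e).diagCoeff φ (k, i) = c i * f.diagCoeff ψ k := by
    intro k i
    change (f.basis.smulTower e.basis).repr (φ ((f.basis.smulTower e.basis) (k, i))) (k, i) = _
    rw [Module.Basis.smulTower_apply, Module.Basis.smulTower_repr_mk, hφψ, map_smul,
      Finsupp.smul_apply]
    change f.basis.repr (_ • e.diagCoeff φ i) k = _
    rw [← hc, smul_eq_mul, mul_comm, ← Algebra.smul_def, map_smul, Finsupp.smul_apply]
    rfl
  ext d
  have hf := f.finite_deg hfinA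
  have he := e.finite_deg hfinM
  have hfe : {k : f.ι × e.ι | f.deg k.1 + e.deg k.2 = d}.Finite :=
    (f.prod hA hM hsmul e).finite_deg hfinM d
  rw [coeff_trace _ _ d hfe, PowerSeries.coeff_mul]
  have hprod : ∀ x : ℕ × ℕ, PowerSeries.coeff x.1 (e.trace φ) * PowerSeries.coeff x.2 (f.trace ψ) =
      ∑ k ∈ (hf x.2).toFinset ×ˢ (he x.1).toFinset, c k.2 * f.diagCoeff ψ k.1 := by
    intro x
    rw [coeff_trace _ _ _ (he x.1), coeff_trace _ _ _ (hf x.2), Finset.sum_mul_sum,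
      Finset.sum_product_right]
    refine Finset.sum_congr rfl fun i _ => Finset.sum_congr rfl fun k _ => ?_
    rw [invFun_algebraMap (hc i),
      invFun_algebraMap (a := f.diagCoeff ψ k) (c := f.diagCoeff ψ k) rfl]
  rw [Finset.sum_congr rfl fun x _ => hprod x]
  refine (Finset.sum_fiberwise_of_maps_to (s := hfe.toFinset)
    (t := Finset.HasAntidiagonal.antidiagonal d)
    (g := fun k : f.ι × e.ι => (e.deg k.2, f.deg k.1)) ?_ _).symm.trans ?_
  · intro k hk
    rw [Set.Finite.mem_toFinset] at hk
    rw [Finset.HasAntidiagonal.mem_antidiagonal, add_comm]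
    exact hk
  · refine Finset.sum_congr rfl fun x hx => ?_
    rw [Finset.HasAntidiagonal.mem_antidiagonal] at hx
    refine Finset.sum_congr ?_ fun k _ => ?_
    · ext k
      rw [Finset.mem_filter, Finset.mem_product, Set.Finite.mem_toFinset, Set.Finite.mem_toFinset,
        Set.Finite.mem_toFinset]
      change (f.deg k.1 + e.deg k.2 = d ∧ (e.deg k.2, f.deg k.1) = x) ↔
        (f.deg k.1 = x.2 ∧ e.deg k.2 = x.1)
      rw [Prod.ext_iff]
      constructor
      · rintro ⟨-, h1, h2⟩; exact ⟨h2, h1⟩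
      · rintro ⟨h1, h2⟩; exact ⟨by omega, h2, h1⟩
    · exact invFun_algebraMap (hdiag k.1 k.2).symm

/-- On a graded algebra with `𝓐 0 = ℂ` the graded trace of a unital map has a nonzero constant
term. -/
lemma HomogeneousBasis.trace_ne_zero (hA : IsScaling 𝓐 sA) [Nontrivial A]
    (hfinA : ∀ d, FiniteDimensional ℂ (𝓐 d))
    (hA0 : ∀ a : A, sA a = a → ∃ c : ℂ, algebraMap ℂ A c = a)
    {ψ : A →ₗ[ℂ] A} (hψ : ∀ d, ∀ a ∈ 𝓐 d, ψ a ∈ 𝓐 d) (hψ1 : ψ 1 = 1)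
    (f : HomogeneousBasis ℂ 𝓐) : f.trace ψ ≠ 0 := by
  intro h
  have h0 := f.coeff_trace_eq_linearMapTrace (sM := sA.toLinearMap) hA hfinA hψ 0
  have hid : ψ.restrict (hψ 0) = LinearMap.id := by
    refine LinearMap.ext fun ⟨a, ha⟩ => Subtype.ext ?_
    obtain ⟨c, rfl⟩ := hA0 a (by rw [(hA _ _).1 ha, pow_zero, one_smul])
    change ψ (algebraMap ℂ A c) = algebraMap ℂ A c
    rw [Algebra.algebraMap_eq_smul_one, map_smul, hψ1]
  have h1 : (1 : A) ∈ 𝓐 0 := (hA _ _).2 (by rw [map_one, pow_zero, one_smul])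
  have := hfinA 0
  have : Nontrivial (𝓐 0) := ⟨⟨⟨1, h1⟩, 0, fun he => one_ne_zero (congrArg Subtype.val he)⟩⟩
  rw [h, map_zero, hid, LinearMap.trace_id, eq_comm, Nat.cast_eq_zero] at h0
  exact Module.finrank_pos.ne' h0

/-- The graded trace over `A` exists and divides the graded trace over `ℂ`, with the quotient
determined by `A`; this is also why it does not depend on the basis. -/
lemma hasGradedTrace_and_gradedTrace_eq_mul (hA : IsScaling 𝓐 sA) (hM : IsScaling 𝓜 sM)
    (hsmul : ∀ (a : A) x, sM (a • x) = sA a • sM x) [Nontrivial A]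
    (hA0 : ∀ a : A, sA a = a → ∃ c : ℂ, algebraMap ℂ A c = a)
    (hfinA : ∀ d, FiniteDimensional ℂ (𝓐 d)) (hfinM : ∀ d, FiniteDimensional ℂ (𝓜 d))
    (hf : Nonempty (HomogeneousBasis ℂ 𝓐)) (he : Nonempty (HomogeneousBasis A 𝓜))
    {φ : M →ₗ[ℂ] M} {ψ : A →ₗ[ℂ] A} (hφψ : ∀ a x, φ (a • x) = ψ a • φ x)
    (hφ : ∀ d, ∀ x ∈ 𝓜 d, φ x ∈ 𝓜 d) (hψ : ∀ d, ∀ a ∈ 𝓐 d, ψ a ∈ 𝓐 d) (hψ1 : ψ 1 = 1) :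
    HasGradedTrace ℂ 𝓐 ψ ∧ HasGradedTrace ℂ 𝓜 φ ∧ HasGradedTrace A 𝓜 φ ∧
      gradedTrace ℂ 𝓜 φ = gradedTrace A 𝓜 φ * gradedTrace ℂ 𝓐 ψ := by
  obtain ⟨f⟩ := hf
  obtain ⟨e₀⟩ := he
  have hscalar : ∀ (e : HomogeneousBasis A 𝓜) i, ∃ c : ℂ, algebraMap ℂ A c = e.diagCoeff φ i :=
    fun e => e.exists_algebraMap_eq_diagCoeff hM hsmul hA0 hφ
  have hmul : ∀ e : HomogeneousBasis A 𝓜,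
      (f.prod hA hM hsmul e).trace φ = e.trace φ * f.trace ψ := fun e =>
    f.trace_prod hA hM hsmul hfinA hfinM e hφψ (hscalar e)
  have h1 : HasGradedTrace ℂ 𝓐 ψ := hasGradedTrace_complex (sM := sA.toLinearMap) hA hfinA hψ ⟨f⟩
  have h2 : HasGradedTrace ℂ 𝓜 φ := hasGradedTrace_complex hM hfinM hφ ⟨f.prod hA hM hsmul e₀⟩
  have h3 : HasGradedTrace A 𝓜 φ :=
    { exists_basis := ⟨e₀⟩
      scalar := hscalar
      finite := fun e d => e.finite_deg hfinM d
      unique := fun e e' => mul_right_cancel₀ (f.trace_ne_zero hA hfinA hA0 hψ hψ1) <| by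
        rw [← hmul, ← hmul]; exact h2.unique _ _ }
  refine ⟨h1, h2, h3, ?_⟩
  rw [h2.gradedTrace_eq (f.prod hA hM hsmul e₀), h3.gradedTrace_eq e₀, h1.gradedTrace_eq f, hmul]

end Trace

/-! ### The scaling of the indeterminates -/

section Scaling

variable {n : ℕ}

/-- The substitution `X k ↦ 2 X k`. -/
noncomputable def scalePoly (n : ℕ) : MvPolynomial (Fin n) ℂ →ₐ[ℂ] MvPolynomial (Fin n) ℂ :=
  aeval fun k => C 2 * X k

lemma scalePoly_monomial (m : Fin n →₀ ℕ) (c : ℂ) :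
    scalePoly n (monomial m c) = (2 : ℂ) ^ m.degree • monomial m c := by
  rw [monomial_eq, map_mul, scalePoly, aeval_C, map_finsuppProd, smul_eq_C_mul, map_pow]
  simp only [map_pow, aeval_X, mul_pow]
  rw [Finsupp.prod_mul, Finsupp.degree_apply, ← Finset.prod_pow_eq_pow_sum, algebraMap_eq]
  exact mul_left_comm _ _ _

lemma coeff_scalePoly (p : MvPolynomial (Fin n) ℂ) (m : Fin n →₀ ℕ) :
    coeff m (scalePoly n p) = 2 ^ m.degree * coeff m p := by
  induction p using MvPolynomial.induction_on' with
  | monomial k c =>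
    rw [scalePoly_monomial, coeff_smul, coeff_monomial, smul_eq_mul]
    split_ifs with h
    · rw [h]
    · rw [mul_zero, mul_zero]
  | add p q hp hq => rw [map_add, coeff_add, coeff_add, hp, hq, mul_add]

lemma isHomogeneous_iff_scalePoly {p : MvPolynomial (Fin n) ℂ} {d : ℕ} :
    p.IsHomogeneous d ↔ scalePoly n p = (2 : ℂ) ^ d • p := by
  rw [MvPolynomial.ext_iff]
  simp only [coeff_scalePoly, coeff_smul, smul_eq_mul]
  constructor
  · intro hp m
    by_cases hm : m.degree = d
    · rw [hm]
    · rw [hp.coeff_eq_zero hm, mul_zero, mul_zero]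
  · intro hp m hm
    have h := mul_right_cancel₀ hm (hp m)
    have hdeg : Finsupp.weight (1 : Fin n → ℕ) m = m.degree := by
      rw [Finsupp.degree_eq_weight_one]; rfl
    rw [hdeg]
    exact Nat.pow_right_injective le_rfl (by exact_mod_cast h)

lemma rename_scalePoly (e : Fin n → Fin n) (p : MvPolynomial (Fin n) ℂ) :
    rename e (scalePoly n p) = scalePoly n (rename e p) := by
  have : (rename e).comp (scalePoly n) = (scalePoly n).comp (rename e) := by
    refine MvPolynomial.algHom_ext fun k => ?_
    simp [scalePoly]
  exact DFunLike.congr_fun this p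

lemma exists_C_of_scalePoly_eq {p : MvPolynomial (Fin n) ℂ} (h : scalePoly n p = p) :
    ∃ c, p = C c := by
  have h0 : p.IsHomogeneous 0 := isHomogeneous_iff_scalePoly.2 (by rw [h, pow_zero, one_smul])
  refine ⟨coeff 0 p, ?_⟩
  rw [← homogeneousComponent_zero, homogeneousComponent_of_mem h0, if_pos rfl]

/-- The scaling of the indeterminates in all coordinates of the big ring. -/
noncomputable def scaleBig (n : ℕ) : BigRing n →ₐ[ℂ] BigRing n :=
  AlgHom.pi fun β => (scalePoly n).comp (Pi.evalAlgHom ℂ _ β)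

/-- The scaling of the indeterminates on a stable subalgebra of the big ring. -/
noncomputable def scaleOn (M : Subalgebra ℂ (BigRing n)) (hM : ∀ x ∈ M, scaleBig n x ∈ M) :
    M →ₐ[ℂ] M :=
  ((scaleBig n).comp M.val).codRestrict M fun x => hM x x.2

lemma isScaling_gradedPart (M : Subalgebra ℂ (BigRing n)) (hM : ∀ x ∈ M, scaleBig n x ∈ M) :
    IsScaling (gradedPart M) (scaleOn M hM) := by
  intro d x
  rw [Subtype.ext_iff, funext_iff]
  exact forall_congr' fun β => isHomogeneous_iff_scalePoly

lemma finiteDimensional_gradedPart (M : Subalgebra ℂ (BigRing n)) (d : ℕ) :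
    FiniteDimensional ℂ (gradedPart M d) := by
  have : FiniteDimensional ℂ (homogeneousSubmodule (Fin n) ℂ d) :=
    Module.Finite.iff_fg.2 (homogeneousSubmodule_fg (Fin n) ℂ d)
  let f : gradedPart M d →ₗ[ℂ] (Equiv.Perm (Fin n) → homogeneousSubmodule (Fin n) ℂ d) :=
    { toFun := fun x β => ⟨x.1.1 β, x.2 β⟩
      map_add' := fun _ _ => rfl
      map_smul' := fun _ _ => rfl }
  refine Module.Finite.of_injective f fun x y hxy => ?_
  refine Subtype.ext (Subtype.ext (funext fun β => ?_))
  exact congrArg Subtype.val (congrFun hxy β)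

lemma dotOn_mem_gradedPart {M : Subalgebra ℂ (BigRing n)} (hM : ∀ w, ∀ x ∈ M, dot n w x ∈ M)
    (w : Equiv.Perm (Fin n)) (d : ℕ) (x : M) (hx : x ∈ gradedPart M d) :
    dotOn M hM w x ∈ gradedPart M d := fun β =>
  (hx (w⁻¹ * β)).rename_isHomogeneous

lemma dot_mul (w : Equiv.Perm (Fin n)) (x y : BigRing n) :
    dot n w (x * y) = dot n w x * dot n w y :=
  funext fun β => map_mul (rename w) (x (w⁻¹ * β)) (y (w⁻¹ * β))

lemma dot_one (w : Equiv.Perm (Fin n)) : dot n w 1 = 1 :=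
  funext fun _ => map_one (rename w)

end Scaling

/-! ### Freeness of the ring of splines over its two polynomial subrings -/

section Rings

variable {n : ℕ}

/-- The pairs `a < b ≤ h a`. -/
def hessenbergPairs (h : HessenbergFunction n) : Finset (Fin n × Fin n) :=
  Finset.univ.filter fun p => p.1 < p.2 ∧ p.2 ≤ h.toFun p.1

lemma mem_hessenbergPairs {h : HessenbergFunction n} {a b : Fin n} :
    (a, b) ∈ hessenbergPairs h ↔ a < b ∧ b ≤ h.toFun a := by
  simp [hessenbergPairs]

lemma isIntervalClosed_hessenbergPairs (h : HessenbergFunction n) :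
    IsIntervalClosed (hessenbergPairs h) := by
  refine ⟨fun a b hab => (mem_hessenbergPairs.1 hab).1, fun a b hab c d hac hcd hdb => ?_⟩
  exact mem_hessenbergPairs.2
    ⟨hcd, hdb.trans ((mem_hessenbergPairs.1 hab).2.trans (h.increasing hac))⟩

/-- Membership in `𝒯_h` in terms of the coordinates in `ℂ[R]`; the edge condition is symmetric in
the two ends of an edge, so that the orientation of the edges plays no role. -/
lemma mem_tymoczkoRing_iff {h : HessenbergFunction n} {x : BigRing n} :
    x ∈ tymoczkoRing h ↔ rCoord x ∈ splines ℂ (hessenbergPairs h) := by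
  constructor
  · intro hx a b hab β
    obtain ⟨h1, h2⟩ := mem_hessenbergPairs.1 hab
    rcases lt_or_ge (β a) (β b) with hlt | hge
    · exact hx a b β _ ⟨h1, h2, hlt, rfl⟩
    · rw [dvd_sub_comm]
      refine hx a b _ β ⟨h1, h2, ?_, by rw [mul_assoc, Equiv.swap_mul_self, mul_one]⟩
      rw [Equiv.Perm.mul_apply, Equiv.Perm.mul_apply, Equiv.swap_apply_left,
        Equiv.swap_apply_right]
      exact lt_of_le_of_ne hge fun he => h1.ne' (β.injective he)
  · rintro hx i j β _ ⟨h1, h2, -, rfl⟩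
    exact hx i j (mem_hessenbergPairs.2 ⟨h1, h2⟩) β

/-- The coordinate in `ℂ[R]` at `β` as a ring homomorphism. -/
noncomputable def rCoordHom (β : Equiv.Perm (Fin n)) : BigRing n →ₐ[ℂ] MvPolynomial (Fin n) ℂ :=
  (rename (β⁻¹ : Equiv.Perm (Fin n))).comp (Pi.evalAlgHom ℂ _ β)

lemma rCoordHom_apply (β : Equiv.Perm (Fin n)) (x : BigRing n) : rCoordHom β x = rCoord x β :=
  rfl

lemma rCoord_rename (g : Equiv.Perm (Fin n) → MvPolynomial (Fin n) ℂ) :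
    rCoord (fun β => rename β (g β)) = g := by
  funext β
  rw [rCoord, rename_rename, ← Equiv.Perm.coe_mul, inv_mul_cancel, Equiv.Perm.coe_one, rename_id,
    AlgHom.id_apply]

lemma eq_zero_of_rCoord {x : BigRing n} (hx : ∀ β, rCoord x β = 0) : x = 0 :=
  funext fun β => (map_eq_zero_iff _ (rename_injective _ (β⁻¹).injective)).1 (hx β)

lemma scaleBig_mem_tymoczkoRing (h : HessenbergFunction n) :
    ∀ x ∈ tymoczkoRing h, scaleBig n x ∈ tymoczkoRing h := by
  intro x hx i j β β' he
  have hr : ∀ γ, rCoord (scaleBig n x) γ = scalePoly n (rCoord x γ) := fun γ =>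
    rename_scalePoly _ _
  have h1 := map_dvd (scalePoly n) (hx i j β β' he)
  have h2 : scalePoly n (X i - X j) = C 2 * (X i - X j) := by
    rw [scalePoly, map_sub, aeval_X, aeval_X, mul_sub]
  rw [h2, map_sub] at h1
  rw [hr, hr]
  exact (dvd_mul_left _ _).trans h1

/-- A subalgebra of the big ring consisting of the families `(τ β) f`, for polynomials `f`, where
`τ β` is a fixed permutation of the indeterminates; both `ℂ[L]` and `ℂ[R]` are of this kind. -/
structure TwistedPoly (A : Subalgebra ℂ (BigRing n)) where
  /-- The permutation of the indeterminates at each coordinate. -/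
  τ : Equiv.Perm (Fin n) → Equiv.Perm (Fin n)
  /-- The parametrization by polynomials. -/
  equiv : MvPolynomial (Fin n) ℂ ≃ₐ[ℂ] A
  equiv_apply : ∀ f β, (equiv f).1 β = rename (τ β) f

/-- The constant families. -/
noncomputable def twistedPolyL (n : ℕ) : TwistedPoly (polyL n) where
  τ _ := 1
  equiv := AlgEquiv.ofInjective _ fun _ _ h => congrFun h 1
  equiv_apply f β := by
    rw [Equiv.Perm.coe_one, rename_id, AlgHom.id_apply]
    rfl

/-- The families `β f`. -/
noncomputable def twistedPolyR (n : ℕ) : TwistedPoly (polyR n) where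
  τ β := β
  equiv := AlgEquiv.ofInjective _ fun _ _ h =>
    rename_injective _ (Equiv.injective (1 : Equiv.Perm (Fin n))) (congrFun h 1)
  equiv_apply _ _ := rfl

namespace TwistedPoly

variable {A : Subalgebra ℂ (BigRing n)} (T : TwistedPoly A)
include T

lemma scaleBig_equiv (f : MvPolynomial (Fin n) ℂ) :
    scaleBig n (T.equiv f).1 = (T.equiv (scalePoly n f)).1 := by
  funext β
  rw [T.equiv_apply, rename_scalePoly, ← T.equiv_apply]
  rfl

lemma scaleBig_mem : ∀ x ∈ A, scaleBig n x ∈ A := by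
  intro x hx
  obtain ⟨f, hf⟩ := T.equiv.surjective ⟨x, hx⟩
  have h := T.scaleBig_equiv f
  rw [hf] at h
  rw [h]
  exact Subtype.property _

lemma scaleOn_equiv (f : MvPolynomial (Fin n) ℂ) :
    scaleOn A T.scaleBig_mem (T.equiv f) = T.equiv (scalePoly n f) :=
  Subtype.ext (T.scaleBig_equiv f)

lemma exists_algebraMap_eq (a : A) (ha : scaleOn A T.scaleBig_mem a = a) :
    ∃ c : ℂ, algebraMap ℂ A c = a := by
  obtain ⟨f, rfl⟩ := T.equiv.surjective a
  rw [T.scaleOn_equiv] at ha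
  obtain ⟨c, rfl⟩ := exists_C_of_scalePoly_eq (T.equiv.injective ha)
  exact ⟨c, (T.equiv.commutes c).symm⟩

/-- The monomials form a homogeneous basis over `ℂ`. -/
lemma nonempty_homogeneousBasis : Nonempty (HomogeneousBasis ℂ (gradedPart A)) := by
  refine ⟨⟨Fin n →₀ ℕ, (basisMonomials (Fin n) ℂ).map T.equiv.toLinearEquiv, Finsupp.degree,
    fun m β => ?_⟩⟩
  rw [Module.Basis.map_apply, coe_basisMonomials]
  change ((T.equiv (monomial m 1)).1 β).IsHomogeneous _
  rw [T.equiv_apply]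
  exact (isHomogeneous_monomial 1 rfl).rename_isHomogeneous

/-- Each coordinate in `ℂ[R]` identifies `A` with the ring of polynomials. -/
lemma bijective_rCoord (β : Equiv.Perm (Fin n)) :
    Function.Bijective ((rCoordHom β).comp A.val) := by
  have h : ∀ f, (rCoordHom β).comp A.val (T.equiv f) =
      renameEquiv ℂ ((T.τ β).trans β⁻¹) f := by
    intro f
    rw [AlgHom.comp_apply, rCoordHom_apply, rCoord]
    change rename _ ((T.equiv f).1 β) = _
    rw [T.equiv_apply, rename_rename]
    rfl
  refine (T.equiv.toEquiv.bijective_comp _).1 ?_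
  convert (renameEquiv ℂ ((T.τ β).trans β⁻¹)).bijective using 1
  exact funext h

/-- The flow-up splines form a homogeneous basis of `𝒯_h` over `A`. -/
lemma nonempty_homogeneousBasis_tymoczkoRing (h : HessenbergFunction n)
    [Module A (tymoczkoRing h)]
    (hsmul : ∀ (a : A) (x : tymoczkoRing h), (a • x).1 = a.1 * x.1) :
    Nonempty (HomogeneousBasis A (gradedPart (tymoczkoRing h))) := by
  have hE := isIntervalClosed_hessenbergPairs h
  choose g hg hgd using exists_isFlowUp_isHomogeneous (K := ℂ) hE
  let p : Equiv.Perm (Fin n) → tymoczkoRing h := fun v =>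
    ⟨fun β => rename β (g v β), mem_tymoczkoRing_iff.2 (by rw [rCoord_rename]; exact (hg v).mem)⟩
  let ev : Equiv.Perm (Fin n) → tymoczkoRing h →+ MvPolynomial (Fin n) ℂ := fun v =>
    ((rCoordHom v).comp (tymoczkoRing h).val : tymoczkoRing h →ₐ[ℂ] MvPolynomial (Fin n) ℂ)
  let σ : Equiv.Perm (Fin n) → A →+* MvPolynomial (Fin n) ℂ := fun v =>
    ((rCoordHom v).comp A.val : A →ₐ[ℂ] MvPolynomial (Fin n) ℂ)
  have hev : ∀ u v, ev u (p v) = g v u := fun u v => congrFun (rCoord_rename (g v)) u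
  have hevsmul : ∀ v a x, ev v (a • x) = σ v a * ev v x := by
    intro v a x
    change rCoordHom v (a • x).1 = rCoordHom v a.1 * rCoordHom v x.1
    rw [hsmul, map_mul]
  have hlt : ∀ u v, u < v → ev u (p v) = 0 := fun u v huv => by
    rw [hev, (hg v).eq_zero u huv]
  have hli : LinearIndependent A p := linearIndependent_of_triangular ev σ p
    (fun v => (T.bijective_rCoord v).1) hevsmul hlt fun v => by
      rw [hev, (hg v).apply_self]
      exact leadingTerm_ne_zero hE v
  have hspan : ⊤ ≤ Submodule.span A (Set.range p) := span_eq_top_of_triangular ev σ p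
    (fun v => (T.bijective_rCoord v).2) hevsmul hlt
    (fun v x hx => by
      rw [hev, (hg v).apply_self]
      exact leadingTerm_dvd hE (mem_tymoczkoRing_iff.1 x.2) hx)
    (fun x hx => Subtype.ext (eq_zero_of_rCoord hx))
  refine ⟨⟨_, Module.Basis.mk hli hspan, fun v => (inversions (hessenbergPairs h) v).card,
    fun v β => ?_⟩⟩
  rw [Module.Basis.mk_apply]
  exact (hgd v β).rename_isHomogeneous

/-- Existence and multiplicativity of the graded traces in the tower `ℂ ⊆ A ⊆ 𝒯_h`. -/
lemma hasGradedTrace_and_eq_mul (h : HessenbergFunction n) [Module A (tymoczkoRing h)]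
    [IsScalarTower ℂ A (tymoczkoRing h)]
    (hsmul : ∀ (a : A) (x : tymoczkoRing h), (a • x).1 = a.1 * x.1)
    (hA : ∀ w, ∀ x ∈ A, dot n w x ∈ A) (w : Equiv.Perm (Fin n)) :
    HasGradedTrace ℂ (gradedPart A) (dotOn A hA w) ∧
      HasGradedTrace ℂ (gradedPart (tymoczkoRing h)) (dotT h w) ∧
      HasGradedTrace A (gradedPart (tymoczkoRing h)) (dotT h w) ∧
      gradedTrace ℂ (gradedPart (tymoczkoRing h)) (dotT h w) =
        gradedTrace A (gradedPart (tymoczkoRing h)) (dotT h w) *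
          gradedTrace ℂ (gradedPart A) (dotOn A hA w) := by
  refine hasGradedTrace_and_gradedTrace_eq_mul
    (sM := (scaleOn (tymoczkoRing h) (scaleBig_mem_tymoczkoRing h)).toLinearMap)
    (isScaling_gradedPart A T.scaleBig_mem)
    (isScaling_gradedPart _ (scaleBig_mem_tymoczkoRing h)) (fun a x => ?_)
    T.exists_algebraMap_eq (finiteDimensional_gradedPart A) (finiteDimensional_gradedPart _)
    T.nonempty_homogeneousBasis (T.nonempty_homogeneousBasis_tymoczkoRing h hsmul) (fun a x => ?_)
    (dotOn_mem_gradedPart _ w) (dotOn_mem_gradedPart _ w) (Subtype.ext (dot_one w))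
  · refine Subtype.ext ?_
    rw [hsmul]
    change scaleBig n (a • x).1 = scaleBig n a.1 * scaleBig n x.1
    rw [hsmul, map_mul]
  · refine Subtype.ext ?_
    rw [hsmul]
    change dot n w (a • x).1 = dot n w a.1 * dot n w x.1
    rw [hsmul, dot_mul]

/-- The graded trace of `w` on `A` over `ℂ` depends only on the conjugacy class of `w`. -/
lemma gradedTrace_eq_of_isConj (hA : ∀ w, ∀ x ∈ A, dot n w x ∈ A)
    (htr : ∀ w, HasGradedTrace ℂ (gradedPart A) (dotOn A hA w)) {v w : Equiv.Perm (Fin n)}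
    (hvw : IsConj v w) :
    gradedTrace ℂ (gradedPart A) (dotOn A hA w) = gradedTrace ℂ (gradedPart A) (dotOn A hA v) := by
  obtain ⟨c, rfl⟩ := isConj_iff.1 hvw
  have hinv : ∀ u v : Equiv.Perm (Fin n), ∀ x, dotOn A hA u (dotOn A hA v x) =
      dotOn A hA (u * v) x := fun u v x => by rw [map_mul]; rfl
  let g : A ≃ₗ[ℂ] A := LinearEquiv.ofLinearMap (dotOn A hA c) (dotOn A hA c⁻¹)
    (LinearMap.ext fun x => by
      rw [LinearMap.comp_apply, hinv, mul_inv_cancel, map_one]; rfl)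
    (LinearMap.ext fun x => by
      rw [LinearMap.comp_apply, hinv, inv_mul_cancel, map_one]; rfl)
  refine gradedTrace_conj T.nonempty_homogeneousBasis (htr v) (htr _) g
    (dotOn_mem_gradedPart hA c) fun x => ?_
  change dotOn A hA (c * v * c⁻¹) (dotOn A hA c x) = dotOn A hA c (dotOn A hA v x)
  rw [hinv, hinv, inv_mul_cancel_right]

end TwistedPoly

end Rings

/-! ### The Kronecker product of Frobenius characteristics -/

section Kronecker

variable {n : ℕ}

lemma zFactor_mul_card (w : Equiv.Perm (Fin n)) :
    zFactor ⟨_, w.partition⟩ *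
      (Finset.univ.filter fun v : Equiv.Perm (Fin n) => IsConj w v).card = n.factorial := by
  set c := w.cycleType with hc
  set k := Fintype.card (Fin n) - w.support.card with hk
  have hone : 1 ∉ c := fun h => by simpa using Equiv.Perm.two_le_of_mem_cycleType h
  have hparts : w.partition.parts = c + Multiset.replicate k 1 := Equiv.Perm.parts_partition
  have hcount : ∀ i ∈ c.toFinset, w.partition.parts.count i = c.count i := by
    intro i hi
    have hi1 : i ≠ 1 := by rintro rfl; exact hone (Multiset.mem_toFinset.1 hi)
    rw [hparts, Multiset.count_add, Multiset.count_replicate, if_neg hi1.symm, add_zero]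
  have hcount1 : w.partition.parts.count 1 = k := by
    rw [hparts, Multiset.count_add, Multiset.count_replicate_self,
      Multiset.count_eq_zero_of_notMem hone, zero_add]
  have hz : zFactor ⟨_, w.partition⟩ =
      (Fintype.card (Fin n) - c.sum).factorial * c.prod *
        ∏ i ∈ c.toFinset, (c.count i).factorial := by
    rw [zFactor, Finset.prod_mul_distrib, ← Finset.prod_multiset_count, hparts,
      Multiset.prod_add, Multiset.prod_replicate, one_pow, mul_one, ← hparts,
      Equiv.Perm.sum_cycleType, ← hk]
    -- The part `1` does not occur if there are no fixed points, and then its factor is `0! = 1`.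
    have hsub : w.partition.parts.toFinset ⊆ insert 1 c.toFinset := by
      intro i hi
      rw [hparts, Multiset.mem_toFinset, Multiset.mem_add] at hi
      rcases hi with hi | hi
      · exact Finset.mem_insert_of_mem (Multiset.mem_toFinset.2 hi)
      · rw [Multiset.eq_of_mem_replicate hi]
        exact Finset.mem_insert_self _ _
    rw [Finset.prod_subset hsub fun i _ hi => by
        rw [Multiset.count_eq_zero_of_notMem fun h => hi (Multiset.mem_toFinset.2 h),
          Nat.factorial_zero],
      Finset.prod_insert fun h => hone (Multiset.mem_toFinset.1 h), hcount1,
      Finset.prod_congr rfl fun i hi => by rw [hcount i hi]]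
    ring
  have hcard : (Finset.univ.filter fun v : Equiv.Perm (Fin n) => IsConj w v).card =
      Nat.card {v : Equiv.Perm (Fin n) | IsConj w v} := by
    rw [Nat.card_eq_fintype_card, ← Set.toFinset_card]
    congr 1
    ext v
    simp
  have h := Equiv.Perm.card_isConj_mul_eq w
  rw [hz, hcard, mul_comm, h, Fintype.card_fin]

/-- The Kronecker product multiplies class functions pointwise: the factor `z` and the size of the
conjugacy class cancel against one factor `1 / n!`. -/
lemma kronecker_sum_powerSum (t u : Equiv.Perm (Fin n) → PowerSeries ℂ)
    (hu : ∀ v w, IsConj v w → u w = u v) :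
    kronecker (PowerSeries ℂ)
      (PowerSeries.C ((n.factorial : ℂ)⁻¹) • ∑ w : Equiv.Perm (Fin n),
        t w • powerSum (PowerSeries ℂ) ⟨_, w.partition⟩)
      (PowerSeries.C ((n.factorial : ℂ)⁻¹) • ∑ w : Equiv.Perm (Fin n),
        u w • powerSum (PowerSeries ℂ) ⟨_, w.partition⟩) =
    PowerSeries.C ((n.factorial : ℂ)⁻¹) • ∑ w : Equiv.Perm (Fin n),
        (t w * u w) • powerSum (PowerSeries ℂ) ⟨_, w.partition⟩ := by
  classical
  have key : ∀ w : Equiv.Perm (Fin n), kronecker (PowerSeries ℂ)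
      (powerSum (PowerSeries ℂ) ⟨_, w.partition⟩)
      (∑ v : Equiv.Perm (Fin n), u v • powerSum (PowerSeries ℂ) ⟨_, v.partition⟩) =
      (n.factorial : PowerSeries ℂ) • u w • powerSum (PowerSeries ℂ) ⟨_, w.partition⟩ := by
    intro w
    have hterm : ∀ v : Equiv.Perm (Fin n), kronecker (PowerSeries ℂ)
        (powerSum (PowerSeries ℂ) ⟨_, w.partition⟩)
        (u v • powerSum (PowerSeries ℂ) ⟨_, v.partition⟩) =
        if IsConj w v then
          zFactor ⟨_, w.partition⟩ • u w • powerSum (PowerSeries ℂ) ⟨_, w.partition⟩ else 0 := by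
      intro v
      rw [map_smul, kronecker_powerSum]
      by_cases hwv : IsConj w v
      · rw [if_pos hwv, if_pos (by rw [Equiv.Perm.partition_eq_of_isConj.1 hwv]), hu w v hwv,
          smul_comm]
      · rw [if_neg hwv, if_neg, smul_zero]
        exact fun h => hwv (Equiv.Perm.partition_eq_of_isConj.2
          (eq_of_heq (Sigma.mk.inj h).2))
    rw [map_sum, Finset.sum_congr rfl fun v _ => hterm v, ← Finset.sum_filter, Finset.sum_const,
      smul_smul, Nat.cast_smul_eq_nsmul, mul_comm]
    congr 1
    convert zFactor_mul_card w
  have hfac : PowerSeries.C ((n.factorial : ℂ)⁻¹) * (n.factorial : PowerSeries ℂ) = 1 := by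
    rw [← map_natCast (PowerSeries.C (R := ℂ)), ← map_mul,
      inv_mul_cancel₀ (Nat.cast_ne_zero.2 n.factorial_ne_zero), map_one]
  rw [map_smul]
  congr 1
  rw [map_smul (kronecker _), LinearMap.smul_apply, map_sum (kronecker _), LinearMap.sum_apply]
  rw [Finset.smul_sum]
  refine Finset.sum_congr rfl fun w _ => ?_
  rw [map_smul (kronecker _), LinearMap.smul_apply, key, smul_comm (t w), smul_smul, hfac, one_smul,
    smul_smul]

end Kronecker

namespace TwistedPoly

variable {n : ℕ} {A : Subalgebra ℂ (BigRing n)} (T : TwistedPoly A)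
include T

lemma gradedFrob_eq_kronecker (h : HessenbergFunction n) [Module A (tymoczkoRing h)]
    [IsScalarTower ℂ A (tymoczkoRing h)]
    (hsmul : ∀ (a : A) (x : tymoczkoRing h), (a • x).1 = a.1 * x.1)
    (hA : ∀ w, ∀ x ∈ A, dot n w x ∈ A) :
    gradedFrob ℂ (gradedPart (tymoczkoRing h)) (dotT h) =
      kronecker (PowerSeries ℂ) (gradedFrob A (gradedPart (tymoczkoRing h)) (dotT h))
        (gradedFrob ℂ (gradedPart A) (dotOn A hA)) := by
  rw [gradedFrob, gradedFrob, gradedFrob, kronecker_sum_powerSum]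
  · congr 1
    refine Finset.sum_congr rfl fun w _ => ?_
    rw [(T.hasGradedTrace_and_eq_mul h hsmul hA w).2.2.2]
  · exact fun v w hvw => T.gradedTrace_eq_of_isConj hA
      (fun w => (T.hasGradedTrace_and_eq_mul h hsmul hA w).1) hvw

end TwistedPoly

end Tymoczko

theorem mainTheorem9 (n : ℕ) (h : HessenbergFunction n) :
    (∀ w : Equiv.Perm (Fin n),
      HasGradedTrace ℂ (gradedPart (tymoczkoRing h)) (dotT h w) ∧
      HasGradedTrace (polyL n) (gradedPart (tymoczkoRing h)) (dotT h w) ∧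
      HasGradedTrace (polyR n) (gradedPart (tymoczkoRing h)) (dotT h w) ∧
      HasGradedTrace ℂ (gradedPart (polyL n)) (dotL n w) ∧
      HasGradedTrace ℂ (gradedPart (polyR n)) (dotR n w)) ∧
    gradedFrob ℂ (gradedPart (tymoczkoRing h)) (dotT h) =
      kronecker (PowerSeries ℂ)
        (gradedFrob (polyL n) (gradedPart (tymoczkoRing h)) (dotT h))
        (gradedFrob ℂ (gradedPart (polyL n)) (dotL n)) ∧
    gradedFrob ℂ (gradedPart (tymoczkoRing h)) (dotT h) =
      kronecker (PowerSeries ℂ)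
        (gradedFrob (polyR n) (gradedPart (tymoczkoRing h)) (dotT h))
        (gradedFrob ℂ (gradedPart (polyR n)) (dotR n)) := by
  have hL := fun w => (twistedPolyL n).hasGradedTrace_and_eq_mul h (fun _ _ => rfl) dot_mem_polyL w
  have hR := fun w => (twistedPolyR n).hasGradedTrace_and_eq_mul h (fun _ _ => rfl) dot_mem_polyR w
  exact ⟨fun w => ⟨(hL w).2.1, (hL w).2.2.1, (hR w).2.2.1, (hL w).1, (hR w).1⟩,
    (twistedPolyL n).gradedFrob_eq_kronecker h (fun _ _ => rfl) dot_mem_polyL,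
    (twistedPolyR n).gradedFrob_eq_kronecker h (fun _ _ => rfl) dot_mem_polyR⟩
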